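/- All polynomials are over the field $\mathbb{F}_2$ with two elements. Let $S\in\mathbb{F}_2[x]$ be nonzero. A divisor $D$ of $S$ is unitary if $\gcd(D,S/D)=1$, and $\gcd_u(S,T)$ denotes the greatest common unitary divisor of $S$ and $T$. A divisor $D$ of $S$ is bi-unitary if $\gcd_u(D,S/D)=1$. The polynomial $S$ is bi-unitary perfect if the sum $\sigma^{**}(S)$ of all its bi-unitary divisors equals $S$. A polynomial is odd if it is coprime to $x(x+1)$. A Mersenne prime is an irreducible polynomial of the form $1+x^a(x+1)^b$ with $a,b\geq 1$ and $\gcd(a,b)=1$. Put $$M_1=1+x+x^2,\quad M_2=1+x+x^3,\quad M_3=1+x^2+x^3,\quad M_4=1+x+x^2+x^3+x^4,\quad M_5=1+x^3+x^4,\quad S_1=1+x+x^4,$$ $$C_8=x^8(x+1)^8M_4M_5,\quad C_9=x^8(x+1)^9M_4M_5^2,\quad C_{10}=x^7(x+1)^{10}M_1^2M_5,$$ $$C_{11}=x^7(x+1)^{13}M_2^2M_3^2,\quad C_{12}=x^9(x+1)^9M_4^2M_5^2,\quad C_{13}=x^{14}(x+1)^{14}M_2^2M_3^2,$$ $$D_1=x^4(x+1)^5M_1^4S_1,\quad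 D_2=x^4(x+1)^5M_1^5S_1^2.$$ Theorem. Let $A\in\mathbb{F}_2[x]$ be a bi-unitary perfect polynomial with exactly four distinct irreducible factors. Then $A(x)$ or $A(x+1)$ belongs to $\{C_8,C_9,C_{10},C_{11},C_{12},C_{13}\}\cup\{D_1,D_2\}$. Moreover, every odd irreducible divisor of each of the polynomials $C_8,\ldots,C_{13}$ is a Mersenne prime. -/

import Mathlib

open Polynomial

noncomputable section

namespace BiunitaryPerfect

/-- `D` is a unitary divisor of `S`: `D` divides `S` and `gcd(D, S / D) = 1`. -/
def IsUnitaryDivisor (D S : (ZMod 2)[X]) : Prop :=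
  ∃ E : (ZMod 2)[X], S = D * E ∧ IsCoprime D E

/-- `G` is the greatest common unitary divisor `gcd_u(S, T)` of `S` and `T`. -/
def IsGcdU (G S T : (ZMod 2)[X]) : Prop :=
  (IsUnitaryDivisor G S ∧ IsUnitaryDivisor G T) ∧
    ∀ D : (ZMod 2)[X], IsUnitaryDivisor D S → IsUnitaryDivisor D T → D ∣ G

/-- `D` is a bi-unitary divisor of `S`: `D` divides `S` and `gcd_u(D, S / D) = 1`. -/
def IsBiunitaryDivisor (D S : (ZMod 2)[X]) : Prop :=
  ∃ E : (ZMod 2)[X], S = D * E ∧ IsGcdU 1 D E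

/-- The set of bi-unitary divisors of a nonzero polynomial is finite, so that the sum defining
`sigmaBU` below is a genuine finite sum. -/
theorem finite_biunitaryDivisors (S : (ZMod 2)[X]) (hS : S ≠ 0) :
    {D : (ZMod 2)[X] | IsBiunitaryDivisor D S}.Finite := by
  let n := S.natDegree + 1
  have hinj : Function.Injective
      (fun (p : degreeLT (ZMod 2) n) => degreeLTEquiv (ZMod 2) n p) :=
    (degreeLTEquiv (ZMod 2) n).injective
  have hfin : Finite (degreeLT (ZMod 2) n) := Finite.of_injective _ hinj
  refine Set.Finite.subset (Set.toFinite (degreeLT (ZMod 2) n : Set (ZMod 2)[X])) ?_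
  rintro D ⟨E, hE, -⟩
  have hdvd : D ∣ S := ⟨E, hE⟩
  rw [SetLike.mem_coe, mem_degreeLT]
  calc D.degree ≤ S.degree := degree_le_of_dvd hdvd hS
    _ = (S.natDegree : WithBot ℕ) := degree_eq_natDegree hS
    _ < (n : WithBot ℕ) := by exact_mod_cast Nat.lt_succ_self _

/-- `σ**(S)`, the sum of all bi-unitary divisors of (a nonzero polynomial) `S`. -/
def sigmaBU (S : (ZMod 2)[X]) : (ZMod 2)[X] :=
  ∑ᶠ D ∈ {D : (ZMod 2)[X] | IsBiunitaryDivisor D S}, D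

/-- `S` is bi-unitary perfect: `S` is nonzero and `σ**(S) = S`. -/
def IsBUP (S : (ZMod 2)[X]) : Prop :=
  S ≠ 0 ∧ sigmaBU S = S

/-- `ω(S)`, the number of distinct irreducible factors of (a nonzero polynomial) `S`. The only
unit of `(ZMod 2)[X]` is `1`, so distinct irreducible polynomials are never associated. -/
def omega (S : (ZMod 2)[X]) : ℕ :=
  {P : (ZMod 2)[X] | Irreducible P ∧ P ∣ S}.ncard

/-- The polynomial `S(x + 1)`. -/
def bar (S : (ZMod 2)[X]) : (ZMod 2)[X] := S.comp (X + 1)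

/-- `S` is odd: `gcd(S, x (x + 1)) = 1`. -/
def IsOdd (S : (ZMod 2)[X]) : Prop := IsCoprime S (X * (X + 1))

/-- `S` is a Mersenne prime: it is irreducible and of the form `1 + x ^ a (x + 1) ^ b` with
`gcd(a, b) = 1`. -/
def IsMersennePrime (S : (ZMod 2)[X]) : Prop :=
  Irreducible S ∧ ∃ a b : ℕ, 0 < a ∧ 0 < b ∧ Nat.Coprime a b ∧ S = 1 + X ^ a * (X + 1) ^ b

def M1 : (ZMod 2)[X] := 1 + X + X ^ 2
def M2 : (ZMod 2)[X] := 1 + X + X ^ 3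
def M3 : (ZMod 2)[X] := 1 + X ^ 2 + X ^ 3
def M4 : (ZMod 2)[X] := 1 + X + X ^ 2 + X ^ 3 + X ^ 4
def M5 : (ZMod 2)[X] := 1 + X ^ 3 + X ^ 4
def S1 : (ZMod 2)[X] := 1 + X + X ^ 4

def C8 : (ZMod 2)[X] := X ^ 8 * (X + 1) ^ 8 * M4 * M5
def C9 : (ZMod 2)[X] := X ^ 8 * (X + 1) ^ 9 * M4 * M5 ^ 2
def C10 : (ZMod 2)[X] := X ^ 7 * (X + 1) ^ 10 * M1 ^ 2 * M5
def C11 : (ZMod 2)[X] := X ^ 7 * (X + 1) ^ 13 * M2 ^ 2 * M3 ^ 2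
def C12 : (ZMod 2)[X] := X ^ 9 * (X + 1) ^ 9 * M4 ^ 2 * M5 ^ 2
def C13 : (ZMod 2)[X] := X ^ 14 * (X + 1) ^ 14 * M2 ^ 2 * M3 ^ 2
def D1 : (ZMod 2)[X] := X ^ 4 * (X + 1) ^ 5 * M1 ^ 4 * S1
def D2 : (ZMod 2)[X] := X ^ 4 * (X + 1) ^ 5 * M1 ^ 5 * S1 ^ 2

end BiunitaryPerfect

end

namespace BiunitaryPerfect

/-! The function σ** is multiplicative on coprime factors, and σ**(T^e) for a prime T is 1 + T + ⋯ +
T^e with the middle term removed when e is even. In characteristic 2 this equals (1+T)^w · `geo u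
T`^α · `geo v T`^β with u, v odd, w > 0, and exponents governed by powers of two (`exists_shape`).

Since w > 0, every prime T dividing a perfect A satisfies 1 + T ∣ A. Hence x and x+1 divide A, and
two odd primes P, Q remain, ordered by degree. A degree count leaves 1+P = x^i(x+1)^j and 1+Q =
x^{i'}(x+1)^{j'}P^l (`exists_oddPair`). Every odd geometric sum occurring in σ**(A) = A must be a
product of powers of P and Q.

At x these sums are squarefree. Comparing 1 + `geo u X` with 1+P and 1+Q, and using orders of roots
of unity over the field with two elements, leaves finitely many u (`OddPair.geoType`); the
substitution x ↦ x+1 handles the base x+1. At P and Q a derivative argument bounds the multiplicity: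
`geo u P` is 1 or Q, the latter only under rigid conditions (`OddPair.pGeoType`), and `geo u Q` is 1
(`OddPair.eq_one_of_geo_Q`).

Comparing the exponents of x, x+1, P, Q in σ**(A) = A then gives four equations, linear once the
type of (P, Q) is fixed, in which powers of two enter only through congruences. Their solution
(`solution_of_eqs`) is exactly the announced list up to x ↦ x+1. The Mersenne statement rests on the
order of 2 modulo 3, 5 and 7. -/

/-! ### Multiplicativity of σ** -/

theorem eq_one_of_isUnit {D : (ZMod 2)[X]} (h : IsUnit D) : D = 1 := by
  obtain ⟨r, hr, rfl⟩ := Polynomial.isUnit_iff.1 h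
  have : r = 1 := by
    have h0 := hr.ne_zero
    clear h hr
    revert r; decide
  rw [this, C_1]

theorem eq_of_associated {D E : (ZMod 2)[X]} (h : Associated D E) : D = E := by
  obtain ⟨u, hu⟩ := h
  rw [← hu, eq_one_of_isUnit u.isUnit, mul_one]

theorem eq_of_dvd_dvd {D E : (ZMod 2)[X]} (h : D ∣ E) (h' : E ∣ D) : D = E :=
  eq_of_associated (associated_of_dvd_dvd h h')

theorem isGcdU_one_iff {D E : (ZMod 2)[X]} : IsGcdU 1 D E ↔
    ∀ G, IsUnitaryDivisor G D → IsUnitaryDivisor G E → G = 1 := by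
  constructor
  · intro h G h1 h2
    exact eq_one_of_isUnit (isUnit_of_dvd_one (h.2 G h1 h2))
  · intro h
    exact ⟨⟨⟨D, (one_mul D).symm, isCoprime_one_left⟩, ⟨E, (one_mul E).symm, isCoprime_one_left⟩⟩,
      fun G h1 h2 => (h G h1 h2) ▸ dvd_rfl⟩

theorem IsUnitaryDivisor.mul_right {G D D' : (ZMod 2)[X]} (h : IsUnitaryDivisor G D)
    (hc : IsCoprime G D') : IsUnitaryDivisor G (D * D') := by
  obtain ⟨E, rfl, hE⟩ := h
  exact ⟨E * D', by ring, hE.mul_right hc⟩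

theorem IsUnitaryDivisor.of_mul {G G' D D' : (ZMod 2)[X]}
    (h : IsUnitaryDivisor (G * G') (D * D')) (hG : G ∣ D) (hG' : G' ∣ D')
    (h0 : D * D' ≠ 0) : IsUnitaryDivisor G D := by
  obtain ⟨F, hF, hc⟩ := h
  obtain ⟨H, rfl⟩ := hG
  obtain ⟨H', rfl⟩ := hG'
  refine ⟨H, rfl, ?_⟩
  have : F = H * H' := by
    have h1 : G * G' ≠ 0 := by
      rintro h1
      apply h0
      rw [hF, h1, zero_mul]
    apply mul_left_cancel₀ h1
    rw [← hF]; ring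
  rw [this] at hc
  exact hc.of_mul_left_left.of_mul_right_left

/-- A common unitary divisor splits along the coprime factorization, and each part is a common
unitary divisor within its own component. -/
theorem IsGcdU.mul {D D' E E' : (ZMod 2)[X]} (h : IsGcdU 1 D E) (h' : IsGcdU 1 D' E')
    (hc : IsCoprime (D * E) (D' * E')) (h0 : D * D' ≠ 0) (h1 : E * E' ≠ 0) :
    IsGcdU 1 (D * D') (E * E') := by
  rw [isGcdU_one_iff] at h h' ⊢
  intro G hG1 hG2
  obtain ⟨G1, G2, d1, d2, rfl⟩ := exists_dvd_and_dvd_of_dvd_mul (Dvd.intro _ hG1.choose_spec.1.symm)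
  have hd : G1 * G2 ∣ E * E' := Dvd.intro _ hG2.choose_spec.1.symm
  have e1 : G1 ∣ E := by
    have : IsCoprime G1 E' := (hc.of_isCoprime_of_dvd_left (d1.mul_right E)).of_isCoprime_of_dvd_right
      (Dvd.intro_left _ rfl)
    exact this.dvd_of_dvd_mul_right ((Dvd.intro _ rfl).trans hd)
  have e2 : G2 ∣ E' := by
    have : IsCoprime G2 E := (hc.symm.of_isCoprime_of_dvd_left
      (d2.mul_right E')).of_isCoprime_of_dvd_right (Dvd.intro_left _ rfl)
    exact this.dvd_of_dvd_mul_left ((Dvd.intro_left _ rfl).trans hd)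
  rw [h G1 (hG1.of_mul d1 d2 h0) (hG2.of_mul e1 e2 h1)]
  rw [mul_comm G1, mul_comm D] at hG1
  rw [mul_comm G1, mul_comm E] at hG2
  rw [h' G2 (hG1.of_mul d2 d1 (by rwa [mul_comm])) (hG2.of_mul e2 e1 (by rwa [mul_comm])), one_mul]

theorem IsGcdU.of_mul {D D' E E' : (ZMod 2)[X]} (h : IsGcdU 1 (D * D') (E * E'))
    (hc : IsCoprime (D * E) (D' * E')) : IsGcdU 1 D E := by
  rw [isGcdU_one_iff] at h ⊢
  intro G h1 h2
  have hG : G ∣ D * E := (Dvd.intro _ h1.choose_spec.1.symm).mul_right E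
  have hcG := hc.of_isCoprime_of_dvd_left hG
  exact h G (h1.mul_right hcG.of_mul_right_left) (h2.mul_right hcG.of_mul_right_right)

theorem isBiunitaryDivisor_mul_iff {S T : (ZMod 2)[X]} (hST : IsCoprime S T) (h0 : S * T ≠ 0)
    {D : (ZMod 2)[X]} : IsBiunitaryDivisor D (S * T) ↔
      ∃ D1 D2, IsBiunitaryDivisor D1 S ∧ IsBiunitaryDivisor D2 T ∧ D = D1 * D2 := by
  constructor
  · rintro ⟨E, hE, hG⟩
    obtain ⟨D1, D2, ⟨E1, rfl⟩, ⟨E2, rfl⟩, rfl⟩ :=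
      exists_dvd_and_dvd_of_dvd_mul (Dvd.intro _ hE.symm)
    have hE' : E = E1 * E2 := by
      have h1 : D1 * D2 ≠ 0 := by
        intro h1
        apply h0
        rw [hE, h1, zero_mul]
      apply mul_left_cancel₀ h1
      rw [← hE]; ring
    subst hE'
    refine ⟨D1, D2, ⟨E1, rfl, hG.of_mul hST⟩, ⟨E2, rfl, ?_⟩, rfl⟩
    rw [mul_comm D1, mul_comm E1] at hG
    exact hG.of_mul hST.symm
  · rintro ⟨D1, D2, ⟨E1, rfl, h1⟩, ⟨E2, rfl, h2⟩, rfl⟩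
    have h0' : D1 * D2 * (E1 * E2) ≠ 0 := by convert h0 using 1; ring
    exact ⟨E1 * E2, by ring, h1.mul h2 hST (left_ne_zero_of_mul h0') (right_ne_zero_of_mul h0')⟩

/-- Multiplication maps pairs of bi-unitary divisors bijectively onto those of the product;
injectivity holds because each factor is recovered from the product by coprimality. -/
theorem sigmaBU_mul {S T : (ZMod 2)[X]} (hST : IsCoprime S T) (h0 : S * T ≠ 0) :
    sigmaBU (S * T) = sigmaBU S * sigmaBU T := by
  have fS := finite_biunitaryDivisors S (left_ne_zero_of_mul h0)
  have fT := finite_biunitaryDivisors T (right_ne_zero_of_mul h0)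
  have hset : {D : (ZMod 2)[X] | IsBiunitaryDivisor D (S * T)} =
      (fun p : (ZMod 2)[X] × (ZMod 2)[X] => p.1 * p.2) ''
        ((fS.toFinset ×ˢ fT.toFinset : Finset _) : Set ((ZMod 2)[X] × (ZMod 2)[X])) := by
    ext D
    simp only [Set.mem_ofPred_eq, isBiunitaryDivisor_mul_iff hST h0, Set.mem_image, Prod.exists,
      Finset.coe_product, Set.Finite.coe_toFinset, Set.mem_prod, and_assoc, eq_comm (a := D)]
  have key : ∀ {D1 D2 D1' D2' : (ZMod 2)[X]}, D1 ∣ S → D2' ∣ T → D1 * D2 = D1' * D2' → D1 ∣ D1' := by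
    intro D1 D2 D1' D2' h1 h2 h
    exact ((hST.of_isCoprime_of_dvd_left h1).of_isCoprime_of_dvd_right h2).dvd_of_dvd_mul_right
      (h ▸ Dvd.intro _ rfl)
  have key' : ∀ {D1 D2 D1' D2' : (ZMod 2)[X]}, D2 ∣ T → D1' ∣ S → D1 * D2 = D1' * D2' → D2 ∣ D2' := by
    intro D1 D2 D1' D2' h1 h2 h
    exact ((hST.symm.of_isCoprime_of_dvd_left h1).of_isCoprime_of_dvd_right h2).dvd_of_dvd_mul_left
      (h ▸ Dvd.intro_left _ rfl)
  have hinj : Set.InjOn (fun p : (ZMod 2)[X] × (ZMod 2)[X] => p.1 * p.2)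
        ((fS.toFinset ×ˢ fT.toFinset : Finset _) : Set ((ZMod 2)[X] × (ZMod 2)[X])) := by
    rintro ⟨D1, D2⟩ hD ⟨D1', D2'⟩ hD' h
    simp only [Finset.coe_product, Set.Finite.coe_toFinset, Set.mem_prod, Set.mem_ofPred_eq] at hD hD' h
    have a1 : D1 ∣ S := Dvd.intro _ hD.1.choose_spec.1.symm
    have a2 : D2 ∣ T := Dvd.intro _ hD.2.choose_spec.1.symm
    have a1' : D1' ∣ S := Dvd.intro _ hD'.1.choose_spec.1.symm
    have a2' : D2' ∣ T := Dvd.intro _ hD'.2.choose_spec.1.symm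
    exact Prod.ext (eq_of_dvd_dvd (key a1 a2' h) (key a1' a2 h.symm))
      (eq_of_dvd_dvd (key' a2 a1' h) (key' a2' a1 h.symm))
  unfold sigmaBU
  rw [hset, finsum_mem_image hinj, finsum_mem_coe_finset, Finset.sum_product,
    finsum_mem_eq_finite_toFinset_sum _ fS, finsum_mem_eq_finite_toFinset_sum _ fT,
    Finset.sum_mul_sum]

/-! ### Bi-unitary divisors of prime powers -/

theorem isUnitaryDivisor_prime_pow {P : (ZMod 2)[X]} (hP : Irreducible P) {G : (ZMod 2)[X]} {n : ℕ}
    (h : IsUnitaryDivisor G (P ^ n)) : G = 1 ∨ G = P ^ n := by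
  obtain ⟨E, hE, hc⟩ := h
  obtain ⟨i, hi, hG⟩ := (dvd_prime_pow hP.prime n).1 (Dvd.intro _ hE.symm)
  obtain rfl := eq_of_associated hG
  rcases Nat.eq_zero_or_pos i with rfl | hi0
  · left; simp
  · right
    have hE' : E = P ^ (n - i) := by
      apply mul_left_cancel₀ (pow_ne_zero i hP.ne_zero)
      rw [← hE, ← pow_add]; congr 1; omega
    subst hE'
    rcases Nat.eq_zero_or_pos (n - i) with h0 | h0
    · congr 1; omega
    · exact absurd (hc.of_isCoprime_of_dvd_left (dvd_pow_self P hi0.ne')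
        |>.of_isCoprime_of_dvd_right (dvd_pow_self P h0.ne'))
        fun h => hP.not_isUnit (isCoprime_self.1 h)

/-- Prime powers have only trivial unitary divisors, so P^i and P^(e-i) share a nontrivial one only
when they coincide, that is, when i is half of e. -/
theorem isBiunitaryDivisor_prime_pow_iff {P : (ZMod 2)[X]} (hP : Irreducible P) {D : (ZMod 2)[X]}
    {e : ℕ} (he : 0 < e) :
    IsBiunitaryDivisor D (P ^ e) ↔ ∃ i, i ≤ e ∧ 2 * i ≠ e ∧ D = P ^ i := by
  constructor
  · rintro ⟨E, hE, hG⟩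
    obtain ⟨i, hi, hD⟩ := (dvd_prime_pow hP.prime e).1 (Dvd.intro _ hE.symm)
    obtain rfl := eq_of_associated hD
    refine ⟨i, hi, ?_, rfl⟩
    rintro rfl
    have hE' : E = P ^ i := by
      apply mul_left_cancel₀ (pow_ne_zero i hP.ne_zero)
      rw [← hE]; ring
    subst hE'
    have hu : IsUnitaryDivisor (P ^ i) (P ^ i) := ⟨1, by simp, isCoprime_one_right⟩
    have := isGcdU_one_iff.1 hG _ hu hu
    exact hP.not_isUnit (isUnit_of_dvd_one (this ▸ dvd_pow_self P (by omega)))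
  · rintro ⟨i, hi, hne, rfl⟩
    refine ⟨P ^ (e - i), by rw [← pow_add]; congr 1; omega, isGcdU_one_iff.2 ?_⟩
    intro G h1 h2
    rcases isUnitaryDivisor_prime_pow hP h1 with h | h
    · exact h
    rcases isUnitaryDivisor_prime_pow hP h2 with h' | h'
    · exact h'
    · have := pow_injective_of_not_isUnit hP.not_isUnit hP.ne_zero (h.symm.trans h')
      omega

theorem sigmaBU_prime_pow {P : (ZMod 2)[X]} (hP : Irreducible P) {e : ℕ} (he : 0 < e) :
    sigmaBU (P ^ e) = ∑ i ∈ (Finset.range (e + 1)).filter (fun i => 2 * i ≠ e), P ^ i := by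
  have hset : {D : (ZMod 2)[X] | IsBiunitaryDivisor D (P ^ e)} = (fun i => P ^ i) ''
      ((Finset.range (e + 1)).filter (fun i => 2 * i ≠ e) : Set ℕ) := by
    ext D
    simp only [Set.mem_ofPred_eq, isBiunitaryDivisor_prime_pow_iff hP he, Set.mem_image,
      Finset.coe_filter, Finset.mem_range, Nat.lt_succ_iff, and_assoc, eq_comm (a := D)]
  unfold sigmaBU
  rw [hset, finsum_mem_image (fun i _ j _ h =>
    pow_injective_of_not_isUnit hP.not_isUnit hP.ne_zero h), finsum_mem_coe_finset]

/-! ### Geometric sums in characteristic 2 -/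

/-- The geometric sum `1 + T + ⋯ + T ^ (n - 1)`. -/
noncomputable def geo (n : ℕ) (T : (ZMod 2)[X]) : (ZMod 2)[X] := ∑ i ∈ Finset.range n, T ^ i

@[simp] theorem geo_one (T : (ZMod 2)[X]) : geo 1 T = 1 := by simp [geo]

@[simp] theorem geo_zero (T : (ZMod 2)[X]) : geo 0 T = 0 := by simp [geo]

theorem geo_succ (n : ℕ) (T : (ZMod 2)[X]) : geo (n + 1) T = T * geo n T + 1 := by
  simp [geo, geom_sum_succ]

theorem geo_mul_one_add (n : ℕ) (T : (ZMod 2)[X]) : geo n T * (1 + T) = 1 + T ^ n := by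
  have := geom_sum_mul T n
  rw [CharTwo.sub_eq_add, CharTwo.sub_eq_add] at this
  rw [geo, add_comm 1 T, this, add_comm]

theorem eq_of_add_eq_zero {S T : (ZMod 2)[X]} (h : S + T = 0) : S = T := by
  rwa [← CharTwo.sub_eq_add, sub_eq_zero] at h

theorem add_self' (S : (ZMod 2)[X]) : S + S = 0 := CharTwo.add_self_eq_zero S

theorem one_add_ne_zero {T : (ZMod 2)[X]} (h : 0 < T.natDegree) : 1 + T ≠ 0 := by
  intro h0
  rw [← eq_of_add_eq_zero h0, natDegree_one] at h
  exact h.false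

theorem one_add_pow_two_pow (T : (ZMod 2)[X]) (r : ℕ) : 1 + T ^ 2 ^ r = (1 + T) ^ 2 ^ r := by
  rw [add_pow_char_pow, one_pow]

theorem geo_mul {T : (ZMod 2)[X]} (hT : 1 + T ≠ 0) (d e : ℕ) :
    geo (d * e) T = geo d T * geo e (T ^ d) := by
  apply mul_right_cancel₀ hT
  rw [geo_mul_one_add, mul_right_comm, geo_mul_one_add, mul_comm (1 + T ^ d), geo_mul_one_add,
    pow_mul]

/-- Frobenius: 1 + T^(2^r u) = (1 + T^u)^(2^r); then one factor 1 + T is cancelled. -/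
theorem geo_two_pow_mul {T : (ZMod 2)[X]} (hT : 1 + T ≠ 0) (r u : ℕ) :
    geo (2 ^ r * u) T = (1 + T) ^ (2 ^ r - 1) * geo u T ^ 2 ^ r := by
  apply mul_right_cancel₀ hT
  have h1 : 1 ≤ 2 ^ r := Nat.one_le_two_pow
  rw [geo_mul_one_add, mul_right_comm, ← pow_succ, Nat.sub_add_cancel h1,
    mul_comm (2 ^ r) u, pow_mul, one_add_pow_two_pow, ← geo_mul_one_add, mul_pow, mul_comm]

theorem isCoprime_geo_self (n : ℕ) (T : (ZMod 2)[X]) : IsCoprime (geo (n + 1) T) T :=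
  ⟨1, geo n T, by rw [geo_succ]; linear_combination (T * geo n T) * (CharTwo.two_eq_zero : (2 : (ZMod 2)[X]) = 0)⟩

/-- Pairing the terms of positive degree shows that the sum is 1 modulo 1 + T. -/
theorem isCoprime_geo_one_add {u : ℕ} (hu : Odd u) {T : (ZMod 2)[X]} (hT : 1 + T ≠ 0) :
    IsCoprime (geo u T) (1 + T) := by
  obtain ⟨m, rfl⟩ := hu
  refine ⟨1, T * geo m (T ^ 2), ?_⟩
  rw [geo_succ, geo_mul hT]
  have : geo 2 T = 1 + T := by simp [geo, Finset.sum_range_succ]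
  rw [this]
  linear_combination (T * (1 + T) * geo m (T ^ 2)) * (CharTwo.two_eq_zero : (2 : (ZMod 2)[X]) = 0)

theorem natDegree_one_add {T : (ZMod 2)[X]} (h : 0 < T.natDegree) :
    (1 + T).natDegree = T.natDegree :=
  natDegree_add_eq_right_of_natDegree_lt (by simpa using h)

theorem geo_ne_zero {n : ℕ} (hn : 0 < n) (T : (ZMod 2)[X]) (hT : 0 < T.natDegree) :
    geo n T ≠ 0 := by
  intro h
  have := geo_mul_one_add n T
  rw [h, zero_mul] at this
  refine one_add_ne_zero ?_ this.symm
  rw [natDegree_pow]; positivity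

theorem natDegree_geo (n : ℕ) {T : (ZMod 2)[X]} (hT : 0 < T.natDegree) :
    (geo n T).natDegree = (n - 1) * T.natDegree := by
  rcases Nat.eq_zero_or_pos n with rfl | hn
  · simp
  have h := congrArg natDegree (geo_mul_one_add n T)
  have hpos : 0 < (T ^ n).natDegree := by rw [natDegree_pow]; positivity
  rw [natDegree_mul (geo_ne_zero hn T hT) (one_add_ne_zero hT), natDegree_one_add hT,
    natDegree_one_add hpos, natDegree_pow] at h
  obtain ⟨m, rfl⟩ : ∃ m, n = m + 1 := ⟨n - 1, by omega⟩
  rw [add_mul] at h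
  simp; omega

theorem geo_comp (n : ℕ) (T R : (ZMod 2)[X]) : (geo n T).comp R = geo n (T.comp R) := by
  simp [geo]

/-! ### Factorization of σ** on prime powers -/

/-- The sum of the bi-unitary divisors of `T ^ e` for `T` irreducible and `e > 0`. -/
noncomputable def buSum (e : ℕ) (T : (ZMod 2)[X]) : (ZMod 2)[X] :=
  ∑ i ∈ (Finset.range (e + 1)).filter (fun i => 2 * i ≠ e), T ^ i

theorem buSum_of_odd {e : ℕ} (he : Odd e) (T : (ZMod 2)[X]) : buSum e T = geo (e + 1) T := by
  unfold buSum geo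
  congr 1
  apply Finset.filter_true_of_mem
  rintro i -
  obtain ⟨m, rfl⟩ := he
  omega

/-- Multiplied by 1 + T, the sum without its middle term becomes 1 + T^n + T^(n+1) + T^(2n+1) = (1 +
T^n)(1 + T^(n+1)). -/
theorem buSum_of_even {n : ℕ} {T : (ZMod 2)[X]} (hT : 1 + T ≠ 0) :
    buSum (2 * n) T = (1 + T) * geo n T * geo (n + 1) T := by
  have h1 : buSum (2 * n) T + T ^ n = geo (2 * n + 1) T := by
    unfold buSum geo
    rw [← Finset.sum_filter_add_sum_filter_not (Finset.range (2 * n + 1)) (fun i => 2 * i ≠ 2 * n)]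
    congr 1
    rw [Finset.sum_eq_single n]
    · intro b hb hbn
      simp only [Finset.mem_filter] at hb
      omega
    · intro h
      exact absurd (Finset.mem_filter.2 ⟨Finset.mem_range.2 (by omega), by simp⟩) h
  apply mul_right_cancel₀ hT
  have h2 := geo_mul_one_add (2 * n + 1) T
  have h3 : (1 + T) * geo n T * geo (n + 1) T * (1 + T) = (1 + T ^ n) * (1 + T ^ (n + 1)) := by
    rw [← geo_mul_one_add n, ← geo_mul_one_add (n + 1)]; ring
  rw [h3]
  rw [← h1] at h2
  linear_combination h2 - (T ^ n * (1 + T)) * (CharTwo.two_eq_zero : (2 : (ZMod 2)[X]) = 0)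

/-- The exponents occurring in the factorization
`buSum e T = (1 + T) ^ w * geo u T ^ α * geo v T ^ β` with `u` and `v` odd. -/
def Shape (e w u α v β : ℕ) : Prop :=
  (∃ s, 1 ≤ s ∧ Odd u ∧ e + 1 = 2 ^ s * u ∧ w + 1 = 2 ^ s ∧ α = 2 ^ s ∧ v = 1 ∧ β = 1) ∨
  (∃ n r, 1 ≤ r ∧ Odd u ∧ Odd v ∧ e = 2 * n ∧ w = 2 ^ r ∧ α = 1 ∧ β = 2 ^ r ∧
    ((n = u ∧ n + 1 = 2 ^ r * v) ∨ (n = 2 ^ r * v ∧ n + 1 = u)))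

theorem Shape.odd {e w u α v β : ℕ} (h : Shape e w u α v β) :
    Odd u ∧ Odd v ∧ 0 < α ∧ 0 < β := by
  rcases h with ⟨s, _, hu, _, _, rfl, rfl, rfl⟩ | ⟨n, r, _, hu, hv, _, _, rfl, rfl, _⟩
  · exact ⟨hu, odd_one, by positivity, by positivity⟩
  · exact ⟨hu, hv, by positivity, by positivity⟩

/-- For e = 2n exactly one of n, n+1 is even, and its 2-part supplies the power of 1 + T and the
Frobenius exponent; for odd e the 2-part of e+1 plays this role. -/
theorem exists_shape {e : ℕ} (he : 0 < e) : ∃ w u α v β, Shape e w u α v β ∧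
    ∀ T : (ZMod 2)[X], 1 + T ≠ 0 → buSum e T = (1 + T) ^ w * geo u T ^ α * geo v T ^ β := by
  rcases Nat.even_or_odd' e with ⟨n, rfl | rfl⟩
  · rcases Nat.even_or_odd n with hn | hn
    · obtain ⟨r, v, hv, hr⟩ := Nat.exists_eq_two_pow_mul_odd (n := n) (by omega)
      have hr1 : 1 ≤ r := by
        rcases Nat.eq_zero_or_pos r with rfl | h
        · rw [hr, pow_zero, one_mul] at hn
          exact absurd hn (Nat.not_even_iff_odd.2 hv)
        · exact h
      refine ⟨2 ^ r, n + 1, 1, v, 2 ^ r,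
        Or.inr ⟨n, r, hr1, hn.add_one, hv, rfl, rfl, rfl, rfl, Or.inr ⟨hr, rfl⟩⟩, fun T hT => ?_⟩
      have h1 : (1 + T) ^ 2 ^ r = (1 + T) * (1 + T) ^ (2 ^ r - 1) := by
        rw [← pow_succ', Nat.sub_add_cancel Nat.one_le_two_pow]
      rw [buSum_of_even hT, h1]
      conv_lhs => enter [1, 2]; rw [hr, geo_two_pow_mul hT]
      ring
    · obtain ⟨r, v, hv, hr⟩ := Nat.exists_eq_two_pow_mul_odd (n := n + 1) (by omega)
      have hr1 : 1 ≤ r := by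
        rcases Nat.eq_zero_or_pos r with rfl | h
        · rw [pow_zero, one_mul] at hr
          rw [← hr] at hv
          exact absurd hn.add_one (Nat.not_even_iff_odd.2 hv)
        · exact h
      refine ⟨2 ^ r, n, 1, v, 2 ^ r,
        Or.inr ⟨n, r, hr1, hn, hv, rfl, rfl, rfl, rfl, Or.inl ⟨rfl, hr⟩⟩, fun T hT => ?_⟩
      have h1 : (1 + T) ^ 2 ^ r = (1 + T) * (1 + T) ^ (2 ^ r - 1) := by
        rw [← pow_succ', Nat.sub_add_cancel Nat.one_le_two_pow]
      rw [buSum_of_even hT, h1, hr, geo_two_pow_mul hT]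
      ring
  · obtain ⟨s, u, hu, hs⟩ := Nat.exists_eq_two_pow_mul_odd (n := 2 * n + 1 + 1) (by omega)
    have hs1 : 1 ≤ s := by
      rcases Nat.eq_zero_or_pos s with rfl | h
      · rw [pow_zero, one_mul] at hs
        obtain ⟨m, rfl⟩ := hu
        omega
      · exact h
    -- The second geometric factor is a dummy here: `geo 1 T` is 1.
    refine ⟨2 ^ s - 1, u, 2 ^ s, 1, 1,
      Or.inl ⟨s, hs1, hu, hs, Nat.sub_add_cancel Nat.one_le_two_pow, rfl, rfl, rfl⟩, fun T hT => ?_⟩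
    rw [buSum_of_odd ⟨n, rfl⟩, hs, geo_two_pow_mul hT]
    simp

/-! ### Prime factors of geometric sums at x -/

theorem isCoprime_geo_X {u : ℕ} (hu : Odd u) : IsCoprime (geo u X) X := by
  obtain ⟨m, rfl⟩ := hu
  exact isCoprime_geo_self _ _

theorem one_add_X_ne_zero : (1 + X : (ZMod 2)[X]) ≠ 0 := one_add_ne_zero (by simp)

theorem squarefree_geo_X {u : ℕ} (hu : Odd u) : Squarefree (geo u X) := by
  have h : (X ^ u - C 1 : (ZMod 2)[X]).Separable := by
    apply separable_X_pow_sub_C _ _ one_ne_zero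
    obtain ⟨m, rfl⟩ := hu
    have h2 : (2 : ZMod 2) = 0 := by decide
    push_cast
    rw [h2]; simp
  refine h.squarefree.squarefree_of_dvd ⟨1 + X, ?_⟩
  rw [geo_mul_one_add, CharTwo.sub_eq_add, add_comm, C_1]

/-- The roots of T are u-th roots of unity, so they lie in the field with 2^m elements. -/
theorem natDegree_dvd_of_dvd_geo {T : (ZMod 2)[X]} (hT : Irreducible T) {u m : ℕ}
    (h : T ∣ geo u X) (hum : u ∣ 2 ^ m - 1) : T.natDegree ∣ m := by
  apply hT.natDegree_dvd_of_dvd_X_pow_card_pow_sub_X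
  rw [Nat.card_zmod]
  have h1 : (X ^ u - 1 : (ZMod 2)[X]) ∣ X ^ (2 ^ m - 1) - 1 := by
    obtain ⟨c, hc⟩ := hum
    rw [hc, pow_mul]
    exact sub_one_dvd_pow_sub_one _ _
  have h2 : (X ^ 2 ^ m - X : (ZMod 2)[X]) = X * (X ^ (2 ^ m - 1) - 1) := by
    rw [mul_sub, ← pow_succ', Nat.sub_add_cancel Nat.one_le_two_pow, mul_one]
  rw [h2]
  refine Dvd.dvd.mul_left (h.trans (Dvd.dvd.trans ⟨1 + X, ?_⟩ h1)) _
  rw [geo_mul_one_add, CharTwo.sub_eq_add, add_comm]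

/-- As u is prime and T does not divide x - 1, the class of x modulo T has order exactly u, and this
order divides that of the multiplicative group of the residue field. -/
theorem dvd_two_pow_natDegree_sub_one {T : (ZMod 2)[X]} (hT : Irreducible T) {u : ℕ}
    (hu : u.Prime) (hodd : Odd u) (h : T ∣ geo u X) : u ∣ 2 ^ T.natDegree - 1 := by
  have hX : ¬ T ∣ X := fun h' =>
    hT.not_isUnit ((isCoprime_geo_X hodd).isUnit_of_dvd' h h')
  have hX1 : ¬ T ∣ X - 1 := fun h' => by
    rw [CharTwo.sub_eq_add, add_comm] at h'
    exact hT.not_isUnit ((isCoprime_geo_one_add hodd one_add_X_ne_zero).isUnit_of_dvd' h h')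
  have hmk : ∀ n, T ∣ X ^ n - 1 ↔ AdjoinRoot.mk T X ^ n = 1 := fun n => by
    rw [← AdjoinRoot.mk_eq_zero, map_sub, map_pow, map_one, sub_eq_zero]
  have h1 : T ∣ X ^ u - 1 := h.trans ⟨1 + X, by
    rw [geo_mul_one_add, CharTwo.sub_eq_add, add_comm]⟩
  have h2 : T ∣ X ^ (2 ^ T.natDegree - 1) - 1 := by
    have := hT.natDegree_dvd_iff_dvd_X_pow_card_pow_sub_X.1 dvd_rfl
    rw [Nat.card_zmod] at this
    have h2 : (X ^ 2 ^ T.natDegree - X : (ZMod 2)[X]) = X * (X ^ (2 ^ T.natDegree - 1) - 1) := by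
      rw [mul_sub, ← pow_succ', Nat.sub_add_cancel Nat.one_le_two_pow, mul_one]
    rw [h2] at this
    exact (hT.prime.dvd_or_dvd this).resolve_left hX
  have h3 := orderOf_dvd_of_pow_eq_one ((hmk _).1 h1)
  have h4 := orderOf_dvd_of_pow_eq_one ((hmk _).1 h2)
  rcases (Nat.dvd_prime hu).1 h3 with h5 | h5
  · rw [orderOf_eq_one_iff] at h5
    exact absurd ((hmk 1).2 (by rw [h5, one_pow])) (by rwa [pow_one])
  · rwa [h5] at h4

theorem two_eq_zero' : (2 : (ZMod 2)[X]) = 0 := CharTwo.two_eq_zero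

theorem pow_mul_cancel {T R R' : (ZMod 2)[X]} (hT : Irreducible T) (hR : ¬ T ∣ R) (hR' : ¬ T ∣ R')
    {m n : ℕ} (h : T ^ m * R = T ^ n * R') : m = n ∧ R = R' := by
  wlog hmn : m ≤ n generalizing m n R R'
  · have := this hR' hR h.symm (by omega)
    exact ⟨this.1.symm, this.2.symm⟩
  obtain ⟨k, rfl⟩ := Nat.exists_eq_add_of_le hmn
  rw [pow_add, mul_assoc] at h
  have h1 := mul_left_cancel₀ (pow_ne_zero m hT.ne_zero) h
  rcases Nat.eq_zero_or_pos k with rfl | hk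
  · exact ⟨rfl, by simpa using h1⟩
  · exact absurd (h1 ▸ (dvd_pow_self T hk.ne').mul_right R') hR

theorem natDegree_one_add_X : (1 + X : (ZMod 2)[X]).natDegree = 1 := by
  rw [natDegree_one_add (by simp), natDegree_X]

theorem irreducible_one_add_X : Irreducible (1 + X : (ZMod 2)[X]) :=
  irreducible_of_degree_eq_one
    (by rw [degree_eq_natDegree one_add_X_ne_zero, natDegree_one_add_X]; rfl)

theorem isCoprime_X_one_add_X : IsCoprime (X : (ZMod 2)[X]) (1 + X) :=
  ⟨1, 1, by linear_combination X * two_eq_zero'⟩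

/-! ### Odd polynomials and pairs of odd primes -/

/-- Being coprime to `X` and to `1 + X`. -/
def Odd' (S : (ZMod 2)[X]) : Prop := IsCoprime S X ∧ IsCoprime S (1 + X)

theorem Odd'.not_X_dvd {S : (ZMod 2)[X]} (h : Odd' S) : ¬ X ∣ S := fun h' =>
  irreducible_X.not_isUnit (h.1.isUnit_of_dvd' h' dvd_rfl)

theorem Odd'.not_one_add_X_dvd {S : (ZMod 2)[X]} (h : Odd' S) : ¬ (1 + X) ∣ S := fun h' =>
  irreducible_one_add_X.not_isUnit (h.2.isUnit_of_dvd' h' dvd_rfl)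

theorem Odd'.pow {S : (ZMod 2)[X]} (h : Odd' S) (n : ℕ) : Odd' (S ^ n) :=
  ⟨h.1.pow_left, h.2.pow_left⟩

theorem Odd'.mul {S T : (ZMod 2)[X]} (h : Odd' S) (h' : Odd' T) : Odd' (S * T) :=
  ⟨h.1.mul_left h'.1, h.2.mul_left h'.2⟩

theorem odd_geo_X {u : ℕ} (hu : Odd u) : Odd' (geo u X) :=
  ⟨isCoprime_geo_X hu, isCoprime_geo_one_add hu one_add_X_ne_zero⟩

theorem X_pow_mul_cancel {R R' : (ZMod 2)[X]} (hR : Odd' R) (hR' : Odd' R') {a b a' b' : ℕ}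
    (h : X ^ a * (1 + X) ^ b * R = X ^ a' * (1 + X) ^ b' * R') : a = a' ∧ b = b' ∧ R = R' := by
  have aux : ∀ {b : ℕ} {R : (ZMod 2)[X]}, Odd' R → ¬ (X : (ZMod 2)[X]) ∣ (1 + X) ^ b * R :=
    fun hR h => irreducible_X.not_isUnit
      ((isCoprime_X_one_add_X.symm.pow_left.mul_left hR.1).isUnit_of_dvd' h dvd_rfl)
  rw [mul_assoc, mul_assoc] at h
  obtain ⟨h1, h2⟩ := pow_mul_cancel irreducible_X (aux hR) (aux hR') h
  obtain ⟨h3, h4⟩ := pow_mul_cancel irreducible_one_add_X hR.not_one_add_X_dvd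
    hR'.not_one_add_X_dvd h2
  exact ⟨h1, h3, h4⟩

/-- Here 1 + `geo u T` = T · `geo (u - 1) T` with u - 1 even. Comparing this with a known
factorization of 1 + P or 1 + Q is the main tool for pinning down u. -/
theorem one_add_geo {u : ℕ} (hu : Odd u) (hu1 : u ≠ 1) : ∃ s t, 1 ≤ s ∧ Odd t ∧ u = 2 ^ s * t + 1 ∧
    ∀ T : (ZMod 2)[X], 1 + T ≠ 0 →
      1 + geo u T = T * (1 + T) ^ (2 ^ s - 1) * geo t T ^ 2 ^ s := by
  obtain ⟨m, rfl⟩ := hu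
  obtain ⟨s, t, ht, hs⟩ := Nat.exists_eq_two_pow_mul_odd (n := 2 * m) (by omega)
  refine ⟨s, t, ?_, ht, by omega, fun T hT => ?_⟩
  · rcases Nat.eq_zero_or_pos s with rfl | h
    · obtain ⟨k, rfl⟩ := ht
      omega
    · exact h
  · rw [geo_succ, hs, geo_two_pow_mul hT]
    linear_combination two_eq_zero'

/-- `P` and `Q` are distinct odd primes with `1 + P` and `1 + Q` factored as prescribed. -/
structure OddPair (P Q : (ZMod 2)[X]) (i j i' j' l : ℕ) : Prop where
  irrP : Irreducible P
  irrQ : Irreducible Q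
  ne : P ≠ Q
  oddP : Odd' P
  oddQ : Odd' Q
  eqP : 1 + P = X ^ i * (1 + X) ^ j
  eqQ : 1 + Q = X ^ i' * (1 + X) ^ j' * P ^ l
  deg_le : P.natDegree ≤ Q.natDegree
  hi : 0 < i
  hj : 0 < j
  hi' : 0 < i'
  hj' : 0 < j'

theorem natDegree_X_pow_mul (i j : ℕ) :
    (X ^ i * (1 + X) ^ j : (ZMod 2)[X]).natDegree = i + j := by
  rw [natDegree_mul (pow_ne_zero _ X_ne_zero) (pow_ne_zero _ one_add_X_ne_zero), natDegree_pow,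
    natDegree_pow, natDegree_X, natDegree_one_add_X, mul_one, mul_one]

theorem OddPair.natDegree_P {P Q : (ZMod 2)[X]} {i j i' j' l : ℕ} (h : OddPair P Q i j i' j' l) :
    P.natDegree = i + j := by
  rw [← natDegree_one_add h.irrP.natDegree_pos, h.eqP, natDegree_X_pow_mul]

theorem OddPair.natDegree_Q {P Q : (ZMod 2)[X]} {i j i' j' l : ℕ} (h : OddPair P Q i j i' j' l) :
    Q.natDegree = i' + j' + l * (i + j) := by
  rw [← natDegree_one_add h.irrQ.natDegree_pos, h.eqQ, natDegree_mul _ (pow_ne_zero _ h.irrP.ne_zero),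
    natDegree_X_pow_mul, natDegree_pow, h.natDegree_P]
  exact mul_ne_zero (pow_ne_zero _ X_ne_zero) (pow_ne_zero _ one_add_X_ne_zero)

theorem natDegree_geo_X (u : ℕ) : (geo u X).natDegree = u - 1 := by
  rw [natDegree_geo _ (by simp), natDegree_X, mul_one]

/-! ### Which geometric sums at x are products of P and Q -/

/-- Since 2^s + 1 divides 2^(2s) - 1, the degree 2^s must divide 2s. -/
theorem le_two_of_irreducible_geo {s : ℕ} (hs : 1 ≤ s) (h : Irreducible (geo (2 ^ s + 1) X)) :
    s = 1 ∨ s = 2 := by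
  have h1 := natDegree_dvd_of_dvd_geo (m := 2 * s) h dvd_rfl (by
    refine ⟨2 ^ s - 1, ?_⟩
    rw [← Nat.sq_sub_sq, ← pow_mul, one_pow, mul_comm])
  rw [natDegree_geo_X, Nat.add_sub_cancel] at h1
  have h2 := Nat.le_of_dvd (by omega) h1
  obtain ⟨k, rfl⟩ : ∃ k, s = k + 1 := ⟨s - 1, by omega⟩
  have h3 : 2 ^ k ≤ k + 1 := by rw [pow_succ] at h2; omega
  rcases k with _ | _ | k
  · simp
  · simp
  · exfalso
    have := Nat.lt_two_pow_self (n := k + 1)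
    rw [pow_succ] at h3
    omega

/-- In 1 + `geo u X` the odd part is a power of `geo t X`, while 1 + P has no odd part; so t = 1 and
u = 2^s + 1. -/
theorem mersenne_geo {P : (ZMod 2)[X]} {i j u : ℕ} (hP : Irreducible P)
    (eP : 1 + P = X ^ i * (1 + X) ^ j) (hu : Odd u) (h : geo u X = P) :
    (u = 3 ∧ i = 1 ∧ j = 1) ∨ (u = 5 ∧ i = 1 ∧ j = 3) := by
  have hu1 : u ≠ 1 := by
    rintro rfl
    rw [geo_one] at h
    exact hP.not_isUnit (h ▸ isUnit_one)
  obtain ⟨s, t, hs, ht, rfl, hst⟩ := one_add_geo hu hu1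
  have h1 := hst X one_add_X_ne_zero
  rw [h, eP] at h1
  obtain ⟨h2, h3, h4⟩ := X_pow_mul_cancel (R := 1) (R' := geo t X ^ 2 ^ s)
    ⟨isCoprime_one_left, isCoprime_one_left⟩ ((odd_geo_X ht).pow _)
    (a := i) (b := j) (a' := 1) (b' := 2 ^ s - 1) (by rw [mul_one, pow_one]; exact h1)
  have h5 := congrArg natDegree h4
  rw [natDegree_pow, natDegree_geo_X, natDegree_one] at h5
  have h6 : t = 1 := by
    have : 2 ^ s ≠ 0 := by positivity
    have := (Nat.mul_eq_zero.1 h5.symm).resolve_left this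
    obtain ⟨m, rfl⟩ := ht
    omega
  subst h6
  rw [mul_one] at h ⊢
  rcases le_two_of_irreducible_geo hs (h ▸ hP) with rfl | rfl
  · exact Or.inl ⟨rfl, h2, h3⟩
  · exact Or.inr ⟨rfl, h2, h3⟩

theorem prime_of_irreducible_geo {u : ℕ} (h : Irreducible (geo u X)) (hu : Odd u) : u.Prime := by
  have hu1 : u ≠ 1 := by
    rintro rfl
    rw [geo_one] at h
    exact h.not_isUnit isUnit_one
  by_contra hp
  obtain ⟨d, hd, hd1, hd2⟩ := Nat.exists_dvd_of_not_prime (by obtain ⟨m, rfl⟩ := hu; omega) hp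
  obtain ⟨e, rfl⟩ := hd
  rw [geo_mul one_add_X_ne_zero] at h
  have hd0 : 0 < d := Nat.pos_of_ne_zero (by rintro rfl; simp at hu)
  have he0 : 0 < e := Nat.pos_of_ne_zero (by rintro rfl; simp at hu)
  have he1 : e ≠ 1 := by rintro rfl; simp at hd2
  rcases h.isUnit_or_isUnit rfl with h1 | h1
  · have := natDegree_eq_zero_of_isUnit h1
    rw [natDegree_geo_X] at this
    omega
  · have := natDegree_eq_zero_of_isUnit h1
    rw [natDegree_geo _ (by rw [natDegree_X_pow]; exact hd0), natDegree_X_pow] at this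
    rcases Nat.mul_eq_zero.1 this with h | h <;> omega

/-- For a prime u ≡ 1 mod 8 the number 2 is a square modulo u, so its order divides (u-1)/2 and
prime factors of the sum have degree at most (u-1)/2. -/
theorem mod_eight_ne_one_of_irreducible_geo {u : ℕ} (h : Irreducible (geo u X)) (hu : Odd u) :
    u % 8 ≠ 1 := by
  intro h8
  have hp := prime_of_irreducible_geo h hu
  have : Fact u.Prime := ⟨hp⟩
  have hu2 : u ≠ 2 := by rintro rfl; simp at h8
  obtain ⟨y, hy⟩ := (ZMod.exists_sq_eq_two_iff hu2).2 (Or.inl h8)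
  have hy0 : y ≠ 0 := by
    rintro rfl
    rw [mul_zero] at hy
    have : ((2 : ℕ) : ZMod u) = 0 := by exact_mod_cast hy
    rw [ZMod.natCast_eq_zero_iff] at this
    have := Nat.le_of_dvd (by norm_num) this
    have := hp.two_le
    omega
  have h1 := ZMod.pow_card_sub_one_eq_one hy0
  obtain ⟨m, hm⟩ : ∃ m, u - 1 = 2 * m := ⟨(u - 1) / 2, by omega⟩
  have h2 : u ∣ 2 ^ m - 1 := by
    rw [← ZMod.natCast_eq_zero_iff, Nat.cast_sub Nat.one_le_two_pow]
    push_cast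
    rw [hy, ← pow_two, ← pow_mul, ← hm, h1, sub_self]
  have h3 := natDegree_dvd_of_dvd_geo h dvd_rfl h2
  rw [natDegree_geo_X, hm] at h3
  have := hp.two_le
  have := Nat.le_of_dvd (by omega) h3
  omega

/-- The possible factorizations `geo u X = P ^ p * Q ^ q` for an `OddPair P Q i j i' j' l`. -/
def GeoType (u p q i j i' j' l : ℕ) : Prop :=
  (u = 1 ∧ p = 0 ∧ q = 0) ∨
  (u = 3 ∧ p = 1 ∧ q = 0 ∧ i = 1 ∧ j = 1) ∨
  (u = 3 ∧ p = 0 ∧ q = 1 ∧ i' = 1 ∧ j' = 1 ∧ l = 0) ∨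
  (u = 5 ∧ p = 1 ∧ q = 0 ∧ i = 1 ∧ j = 3) ∨
  (u = 5 ∧ p = 0 ∧ q = 1 ∧ i' = 1 ∧ j' = 3 ∧ l = 0) ∨
  (u = 7 ∧ p = 1 ∧ q = 1 ∧ i = 1 ∧ j = 2 ∧ i' = 2 ∧ j' = 1 ∧ l = 0) ∨
  (u = 7 ∧ p = 1 ∧ q = 1 ∧ i = 2 ∧ j = 1 ∧ i' = 1 ∧ j' = 2 ∧ l = 0) ∨
  (u = 9 ∧ p = 1 ∧ q = 1 ∧ i = 1 ∧ j = 1 ∧ i' = 3 ∧ j' = 1 ∧ l = 1) ∨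
  (u = 25 ∧ p = 1 ∧ q = 1 ∧ i = 1 ∧ j = 3 ∧ i' = 5 ∧ j' = 3 ∧ l = 3) ∨
  (u = 11 ∧ p = 0 ∧ q = 1 ∧ i = 1 ∧ j = 3 ∧ i' = 1 ∧ j' = 1 ∧ l = 2) ∨
  (u = 13 ∧ p = 0 ∧ q = 1 ∧ i = 1 ∧ j = 1 ∧ i' = 1 ∧ j' = 3 ∧ l = 4)

/-- The odd part of 1 + Q gives P^l = `geo t X`^(2^s), so `geo t X` is a power of P, and
squarefreeness makes it 1 or P. The first case is that of a Mersenne Q; the second forces t = 3 or 5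
and l = 2^s. -/
theorem OddPair.geo_eq_Q {P Q : (ZMod 2)[X]} {i j i' j' l u : ℕ} (H : OddPair P Q i j i' j' l)
    (hu : Odd u) (h : geo u X = Q) : GeoType u 0 1 i j i' j' l := by
  have hu1 : u ≠ 1 := by
    rintro rfl
    rw [geo_one] at h
    exact H.irrQ.not_isUnit (h ▸ isUnit_one)
  obtain ⟨s, t, hs, ht, rfl, hst⟩ := one_add_geo hu hu1
  have h1 := hst X one_add_X_ne_zero
  rw [h, H.eqQ] at h1
  obtain ⟨h2, h3, h4⟩ := X_pow_mul_cancel (R := P ^ l) (R' := geo t X ^ 2 ^ s)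
    (H.oddP.pow _) ((odd_geo_X ht).pow _)
    (a := i') (b := j') (a' := 1) (b' := 2 ^ s - 1) (by rw [pow_one]; exact h1)
  obtain ⟨c, -, hc⟩ : ∃ c ≤ l, Associated (geo t X) (P ^ c) := (dvd_prime_pow H.irrP.prime l).1
    (h4 ▸ dvd_pow_self (geo t X) (by positivity : 2 ^ s ≠ 0))
  have hc' := eq_of_associated hc
  have hl : l = c * 2 ^ s := by
    rw [hc', ← pow_mul] at h4
    exact pow_injective_of_not_isUnit H.irrP.not_isUnit H.irrP.ne_zero h4
  have hirr : Irreducible (geo (2 ^ s * t + 1) X) := h ▸ H.irrQ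
  have hc1 : c ≤ 1 := by
    by_contra hc2
    have := squarefree_geo_X ht P (by
      rw [hc', ← pow_two]; exact pow_dvd_pow _ (by omega))
    exact H.irrP.not_isUnit this
  interval_cases c
  · have h6 : t = 1 := by
      have := congrArg natDegree hc'
      rw [natDegree_geo_X, pow_zero, natDegree_one] at this
      obtain ⟨m, rfl⟩ := ht
      omega
    subst h6
    rw [mul_one] at hirr hu h ⊢
    have eQ : 1 + Q = X ^ i' * (1 + X) ^ j' := by rw [H.eqQ, hl, zero_mul, pow_zero, mul_one]
    have h7 := mersenne_geo H.irrQ eQ hu h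
    rw [zero_mul] at hl
    unfold GeoType
    rcases h7 with ⟨h7, h8, h9⟩ | ⟨h7, h8, h9⟩
    · simp [h7, h8, h9, hl]
    · simp [h7, h8, h9, hl]
  · rw [pow_one] at hc'
    have h6 := mersenne_geo H.irrP H.eqP ht hc'
    have h8 := mod_eight_ne_one_of_irreducible_geo hirr hu
    -- For s ≥ 3 one would have u = 2^s t + 1 ≡ 1 mod 8.
    have hs3 : s < 3 := by
      by_contra hs3
      obtain ⟨r, rfl⟩ := Nat.exists_eq_add_of_le (not_lt.1 hs3)
      rw [pow_add, mul_assoc] at h8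
      omega
    unfold GeoType
    -- The candidates are u = 7, 11, 13, 21. The first fails because the degree 6 does not divide 3,
    -- the last because 21 is not prime.
    interval_cases s
    · rcases h6 with ⟨rfl, rfl, rfl⟩ | ⟨rfl, rfl, rfl⟩
      · have := natDegree_dvd_of_dvd_geo (m := 3) hirr dvd_rfl (by norm_num)
        rw [natDegree_geo_X] at this
        norm_num at this
      · omega
    · rcases h6 with ⟨rfl, rfl, rfl⟩ | ⟨rfl, rfl, rfl⟩
      · omega
      · have := prime_of_irreducible_geo hirr hu
        norm_num at this

theorem dvd_mul_of_irreducible {P Q D : (ZMod 2)[X]} (hP : Irreducible P) (hQ : Irreducible Q)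
    (h : D ∣ P * Q) : ∃ x y, x ≤ 1 ∧ y ≤ 1 ∧ D = P ^ x * Q ^ y := by
  obtain ⟨A, B, hA, hB, rfl⟩ := exists_dvd_and_dvd_of_dvd_mul h
  have key : ∀ {P A : (ZMod 2)[X]}, Irreducible P → A ∣ P → ∃ x, x ≤ 1 ∧ A = P ^ x := by
    intro P A hP hA
    obtain ⟨x, hx, hx'⟩ := (dvd_prime_pow hP.prime 1).1 ((pow_one P).symm ▸ hA)
    exact ⟨x, hx, eq_of_associated hx'⟩
  obtain ⟨x, hx, rfl⟩ := key hP hA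
  obtain ⟨y, hy, rfl⟩ := key hQ hB
  exact ⟨x, y, hx, hy, rfl⟩

theorem monic_of_ne_zero {T : (ZMod 2)[X]} (h : T ≠ 0) : T.Monic := by
  have h0 : T.leadingCoeff ≠ 0 := leadingCoeff_ne_zero.2 h
  unfold Monic
  generalize T.leadingCoeff = r at h0
  revert r; decide

theorem nextCoeff_one_add {T : (ZMod 2)[X]} (h : 2 ≤ T.natDegree) :
    (1 + T).nextCoeff = T.nextCoeff := by
  rw [nextCoeff_of_natDegree_pos (by rw [natDegree_one_add (by omega)]; omega),
    nextCoeff_of_natDegree_pos (by omega), natDegree_one_add (by omega), coeff_add, coeff_one,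
    if_neg (by omega), zero_add]

theorem nextCoeff_X_pow (n : ℕ) : (X ^ n : (ZMod 2)[X]).nextCoeff = 0 := by
  rw [monic_X.nextCoeff_pow]
  simp [nextCoeff]

theorem nextCoeff_one_add_X : (1 + X : (ZMod 2)[X]).nextCoeff = 1 := by
  rw [nextCoeff_of_natDegree_pos (by rw [natDegree_one_add_X]; omega), natDegree_one_add_X]
  simp

/-- The second-highest coefficient is additive on products of monic polynomials, so it records the
exponent of 1 + x modulo 2. -/
theorem nextCoeff_X_pow_mul (i j : ℕ) :
    (X ^ i * (1 + X) ^ j : (ZMod 2)[X]).nextCoeff = j := by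
  have h := monic_of_ne_zero one_add_X_ne_zero
  rw [(monic_X.pow i).nextCoeff_mul (h.pow j), nextCoeff_X_pow, h.nextCoeff_pow,
    nextCoeff_one_add_X]
  simp

theorem nextCoeff_geo_X {u : ℕ} (hu : 2 ≤ u) : (geo u X).nextCoeff = 1 := by
  have h := congrArg nextCoeff (geo_mul_one_add u X)
  rw [(monic_of_ne_zero (geo_ne_zero (by omega) X (by simp))).nextCoeff_mul
    (monic_of_ne_zero one_add_X_ne_zero), nextCoeff_one_add_X,
    nextCoeff_one_add (by rw [natDegree_X_pow]; exact hu), nextCoeff_X_pow] at h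
  exact CharTwo.add_eq_zero.1 h

theorem eq_add_one_of_one_add_eq {P R : (ZMod 2)[X]} (h : 1 + P = R) : P = 1 + R := by
  rw [← h]; linear_combination (- 1 : (ZMod 2)[X]) * two_eq_zero'

/-- Expanding 1 + `geo u X` and extracting the powers of x and 1 + x leaves an odd cofactor B, which
must be `geo t X`^(2^s). Parity from the next coefficient gives s = 1, and then B is a square, so
its derivative vanishes. -/
theorem mersenne_mul_of_lt {i j i' j' u : ℕ} (hu : Odd u) (hi : 0 < i) (hj' : 0 < j')
    (hij : i + j = i' + j') (hlt : i < i')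
    (h : geo u X = (1 + X ^ i * (1 + X) ^ j) * (1 + X ^ i' * (1 + X) ^ j')) :
    u = 7 ∧ i = 1 ∧ j = 2 ∧ i' = 2 ∧ j' = 1 := by
  have hd : ∀ i j : ℕ, 0 < i → (1 + X ^ i * (1 + X) ^ j : (ZMod 2)[X]).natDegree = i + j := by
    intro i j hi
    rw [natDegree_one_add (by rw [natDegree_X_pow_mul]; omega), natDegree_X_pow_mul]
  have hne : ∀ i j : ℕ, 0 < i → (1 + X ^ i * (1 + X) ^ j : (ZMod 2)[X]) ≠ 0 := by
    intro i j hi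
    exact one_add_ne_zero (by rw [natDegree_X_pow_mul]; omega)
  have hdeg := congrArg natDegree h
  rw [natDegree_geo_X, natDegree_mul (hne i j hi) (hne i' j' (by omega)), hd i j hi,
    hd i' j' (by omega)] at hdeg
  have hnc := congrArg nextCoeff h
  rw [nextCoeff_geo_X (by omega), (monic_of_ne_zero (hne i j hi)).nextCoeff_mul
    (monic_of_ne_zero (hne i' j' (by omega))),
    nextCoeff_one_add (by rw [natDegree_X_pow_mul]; omega),
    nextCoeff_one_add (by rw [natDegree_X_pow_mul]; omega), nextCoeff_X_pow_mul,
    nextCoeff_X_pow_mul] at hnc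
  have hpar : (j + j') % 2 = 1 := by
    rw [← Nat.cast_add, ← Nat.cast_one, ZMod.natCast_eq_natCast_iff'] at hnc
    omega
  obtain ⟨s, t, hs, ht, rfl, hst⟩ := one_add_geo hu (by omega)
  have h1 := hst X one_add_X_ne_zero
  obtain ⟨m, rfl⟩ := Nat.exists_eq_add_of_lt hlt
  obtain rfl : j = j' + (m + 1) := by omega
  set B : (ZMod 2)[X] := (1 + X) ^ (m + 1) + X ^ (m + 1) + X ^ (i + m + 1) * (1 + X) ^ (j' + (m + 1))
    with hB
  have hB1 : Odd' B := by
    constructor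
    · have : IsCoprime ((1 + X : (ZMod 2)[X]) ^ (m + 1)) X := isCoprime_X_one_add_X.symm.pow_left
      have e : B = (1 + X) ^ (m + 1) + X * (X ^ m + X ^ (i + m) * (1 + X) ^ (j' + (m + 1))) := by
        rw [hB]; ring
      rw [e]
      exact this.add_mul_left_left _
    · have : IsCoprime ((X : (ZMod 2)[X]) ^ (m + 1)) (1 + X) := isCoprime_X_one_add_X.pow_left
      have e : B = X ^ (m + 1) + (1 + X) * ((1 + X) ^ m + X ^ (i + m + 1) * (1 + X) ^ (j' + m)) := by
        rw [hB]; ring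
      rw [e]
      exact this.add_mul_left_left _
  obtain ⟨h2, h3, h4⟩ := X_pow_mul_cancel (R := B) (R' := geo t X ^ 2 ^ s)
    hB1 ((odd_geo_X ht).pow _) (a := i) (b := j') (a' := 1) (b' := 2 ^ s - 1)
    (by rw [pow_one, ← h1, h, hB]; linear_combination (- 1 : (ZMod 2)[X]) * two_eq_zero')
  subst h2
  obtain ⟨r, rfl⟩ : ∃ r, s = r + 1 := ⟨s - 1, by omega⟩
  have hj'o : j' % 2 = 1 := by
    have : 1 ≤ 2 ^ r := Nat.one_le_two_pow
    rw [pow_succ] at h3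
    omega
  -- Since i = 1, j' is odd and m is even, u - 1 = 2(j' + m + 2) is twice an odd number.
  have hr : r = 0 := by
    by_contra hr
    obtain ⟨r', rfl⟩ : ∃ r', r = r' + 1 := ⟨r - 1, by omega⟩
    have h5 : 2 ^ (r' + 1 + 1) * t = 4 * (2 ^ r' * t) := by ring
    rw [h5] at hdeg
    omega
  subst hr
  norm_num at h3
  subst h3
  -- For even m > 0 the derivative of B at 0 is m + 1 = 1, whereas B is a square.
  have hm : m = 0 := by
    by_contra hm
    have h5 := congrArg (fun f => eval 0 (derivative f)) h4
    have h6 : (m : ZMod 2) = 0 := by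
      have : ((m : ℕ) : ZMod 2) = ((0 : ℕ) : ZMod 2) := by
        rw [ZMod.natCast_eq_natCast_iff']; omega
      simpa using this
    simp [hB, derivative_pow, derivative_mul, h6, hm] at h5
    have h7 : (2 : ZMod 2) = 0 := by decide
    simp [h7] at h5
  subst hm
  omega

/-- For prime u both factors have the order of 2 modulo u as degree; equal degrees force l = 0 and
two Mersenne primes. For composite u = de, comparing degrees forces d = e, P = `geo d X` and Q =
`geo d (X ^ d)`, whence u = 9 or 25. -/
theorem OddPair.geo_eq_mul {P Q : (ZMod 2)[X]} {i j i' j' l u : ℕ} (H : OddPair P Q i j i' j' l)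
    (hu : Odd u) (h : geo u X = P * Q) : GeoType u 1 1 i j i' j' l := by
  have hdeg := congrArg natDegree h
  have hle := H.deg_le
  have hp := H.irrP.natDegree_pos
  rw [natDegree_geo_X, natDegree_mul H.irrP.ne_zero H.irrQ.ne_zero] at hdeg
  by_cases hpr : u.Prime
  · have d1 : P.natDegree ∣ Q.natDegree := natDegree_dvd_of_dvd_geo H.irrP (h ▸ Dvd.intro _ rfl)
      (dvd_two_pow_natDegree_sub_one H.irrQ hpr hu (h ▸ Dvd.intro_left _ rfl))
    have d2 : Q.natDegree ∣ P.natDegree := natDegree_dvd_of_dvd_geo H.irrQ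
      (h ▸ Dvd.intro_left _ rfl)
      (dvd_two_pow_natDegree_sub_one H.irrP hpr hu (h ▸ Dvd.intro _ rfl))
    have d3 := Nat.dvd_antisymm d1 d2
    have eP := H.eqP
    have eQ := H.eqQ
    have hi := H.hi
    have hi' := H.hi'
    have hj := H.hj
    have hj' := H.hj'
    rw [H.natDegree_P, H.natDegree_Q] at d3
    have hl : l = 0 := by
      rcases Nat.eq_zero_or_pos l with h0 | h0
      · exact h0
      · have := Nat.mul_le_mul_right (i + j) h0
        omega
    subst hl
    rw [pow_zero, mul_one] at eQ
    have eP' := eq_add_one_of_one_add_eq eP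
    have eQ' := eq_add_one_of_one_add_eq eQ
    rw [zero_mul, add_zero] at d3
    unfold GeoType
    rcases lt_trichotomy i i' with hlt | rfl | hlt
    · have := mersenne_mul_of_lt hu hi hj' d3 hlt (by rw [h, ← eP', ← eQ'])
      simp [this]
    · obtain rfl : j = j' := by omega
      exact absurd (eP'.trans eQ'.symm) H.ne
    · have := mersenne_mul_of_lt hu hi' hj d3.symm hlt (by rw [h, ← eP', ← eQ', mul_comm])
      simp [this]
  · obtain ⟨d, hd, hd1, hd2⟩ := Nat.exists_dvd_of_not_prime (by omega) hpr
    obtain ⟨e, rfl⟩ := hd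
    have hd0 : Odd d := Nat.Odd.of_mul_left hu
    have he0 : Odd e := Nat.Odd.of_mul_right hu
    have hd0' := hd0.pos
    have he0' := he0.pos
    have he1 : e ≠ 1 := by rintro rfl; simp at hd2
    obtain ⟨x, y, hx, hy, hD⟩ := dvd_mul_of_irreducible H.irrP H.irrQ (D := geo d X)
      (by rw [← h, geo_mul one_add_X_ne_zero]; exact Dvd.intro _ rfl)
    obtain ⟨x', y', hx', hy', hE⟩ := dvd_mul_of_irreducible H.irrP H.irrQ (D := geo e X)
      (by rw [← h, mul_comm d, geo_mul one_add_X_ne_zero]; exact Dvd.intro _ rfl)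
    have dD := congrArg natDegree hD
    have dE := congrArg natDegree hE
    rw [natDegree_geo_X, natDegree_mul (pow_ne_zero _ H.irrP.ne_zero)
      (pow_ne_zero _ H.irrQ.ne_zero), natDegree_pow, natDegree_pow] at dD dE
    set p := P.natDegree
    set q := Q.natDegree
    -- If the two proper sums were P and Q, degrees would give (d-1)(e-1) = 0; if both were Q, then
    -- P would have the larger degree.
    have hxy : x = 1 ∧ y = 0 ∧ d = e := by
      obtain ⟨d', rfl⟩ : ∃ d', d = d' + 2 := ⟨d - 2, by omega⟩
      obtain ⟨e', rfl⟩ : ∃ e', e = e' + 2 := ⟨e - 2, by omega⟩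
      have hexp : (d' + 2) * (e' + 2) = d' * e' + 2 * d' + 2 * e' + 4 := by ring
      rw [hexp] at hdeg
      interval_cases x <;> interval_cases y <;> interval_cases x' <;> interval_cases y' <;>
        omega
    obtain ⟨rfl, rfl, rfl⟩ := hxy
    rw [pow_one, pow_zero, mul_one] at hD
    have hQ : Q = geo d (X ^ d) := by
      apply mul_left_cancel₀ H.irrP.ne_zero
      rw [← h, geo_mul one_add_X_ne_zero, hD]
    have fin : ∀ s, d = 2 ^ s + 1 → i' = d ∧ j' = 2 ^ s - 1 ∧ l = 2 ^ s - 1 := by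
      intro s hs
      have hX : 1 + (X ^ d : (ZMod 2)[X]) ≠ 0 := one_add_ne_zero (by rw [natDegree_X_pow]; exact hd0')
      have h2 : 1 + Q = X ^ d * (1 + X) ^ (2 ^ s - 1) * P ^ (2 ^ s - 1) := by
        have : geo (2 ^ s) (X ^ d : (ZMod 2)[X]) = (1 + X ^ d) ^ (2 ^ s - 1) := by
          have := geo_two_pow_mul hX s 1
          rwa [mul_one, geo_one, one_pow, mul_one] at this
        rw [hQ]
        conv_lhs => enter [2, 1]; rw [hs]
        rw [geo_succ, this, ← geo_mul_one_add, hD, mul_pow]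
        linear_combination two_eq_zero'
      rw [H.eqQ] at h2
      obtain ⟨h3, h4, h5⟩ := X_pow_mul_cancel (H.oddP.pow _) (H.oddP.pow _) h2
      exact ⟨h3, h4, pow_injective_of_not_isUnit H.irrP.not_isUnit H.irrP.ne_zero h5⟩
    unfold GeoType
    rcases mersenne_geo H.irrP H.eqP hd0 hD with ⟨h1, h2, h3⟩ | ⟨h1, h2, h3⟩
    · obtain ⟨h4, h5, h6⟩ := fin 1 h1
      norm_num at h5 h6
      subst h1
      simp [h2, h3, h4, h5, h6]
    · obtain ⟨h4, h5, h6⟩ := fin 2 h1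
      norm_num at h5 h6
      subst h1
      simp [h2, h3, h4, h5, h6]

theorem OddPair.geoType {P Q : (ZMod 2)[X]} {i j i' j' l u p q : ℕ}
    (H : OddPair P Q i j i' j' l) (hu : Odd u) (hp : p ≤ 1) (hq : q ≤ 1)
    (h : geo u X = P ^ p * Q ^ q) : GeoType u p q i j i' j' l := by
  interval_cases p <;> interval_cases q <;> simp only [pow_zero, pow_one, one_mul, mul_one] at h
  · have := congrArg natDegree h
    rw [natDegree_geo_X, natDegree_one] at this
    have := hu.pos
    exact Or.inl ⟨by omega, rfl, rfl⟩
  · exact H.geo_eq_Q hu h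
  · unfold GeoType
    rcases mersenne_geo H.irrP H.eqP hu h with h | h <;> simp [h]
  · exact H.geo_eq_mul hu h

/-! ### Exponent tables and the system of exponent equations -/

/-- This is all that the later linear arithmetic needs to know about powers of two. -/
theorem two_pow_cases {s : ℕ} (hs : 1 ≤ s) :
    2 ^ s = 2 ∨ 2 ^ s = 4 ∨ 2 ^ s = 8 ∨ 16 ∣ 2 ^ s := by
  rcases s with _ | _ | _ | _ | s
  · omega
  · simp
  · simp
  · simp
  · exact Or.inr (Or.inr (Or.inr ⟨2 ^ s, by ring⟩))

/-- For an `OddPair P Q i j i' j' l`, the factor `buSum a X` is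
`(1 + X) ^ w * P ^ p * Q ^ q`. -/
def XSide (a w p q i j i' j' l : ℕ) : Prop :=
  ∃ u α v β pu qu pv qv, Shape a w u α v β ∧ GeoType u pu qu i j i' j' l ∧
    GeoType v pv qv i j i' j' l ∧ p = pu * α + pv * β ∧ q = qu * α + qv * β

/-- The factorizations `geo u P = Q ^ c`. -/
def PGeoType (u c i j i' j' l : ℕ) : Prop :=
  (c = 0 ∧ u = 1) ∨
  (c = 1 ∧ l = 1 ∧ ∃ s, 1 ≤ s ∧ u = 2 ^ s + 1 ∧ i' + i = 2 ^ s * i ∧ j' + j = 2 ^ s * j)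

/-- For an `OddPair P Q i j i' j' l`, the factor `buSum h P` is `(1 + P) ^ w * Q ^ c`. -/
def PSide (h w c i j i' j' l : ℕ) : Prop :=
  ∃ u α v β cu cv, Shape h w u α v β ∧ PGeoType u cu i j i' j' l ∧
    PGeoType v cv i j i' j' l ∧ c = cu * α + cv * β

/-- The odd exponents in `buSum a X`. -/
def XRowOdd (a w p q i j i' j' l : ℕ) : Prop :=
  ∃ y, 0 < y ∧ (y = 2 ∨ y = 4 ∨ y = 8 ∨ 16 ∣ y) ∧ w + 1 = y ∧
  ((a + 1 = y ∧ p = 0 ∧ q = 0) ∨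
  (a + 1 = 3 * y ∧ p = y ∧ q = 0 ∧ i = 1 ∧ j = 1) ∨
  (a + 1 = 3 * y ∧ p = 0 ∧ q = y ∧ i' = 1 ∧ j' = 1 ∧ l = 0) ∨
  (a + 1 = 5 * y ∧ p = y ∧ q = 0 ∧ i = 1 ∧ j = 3) ∨
  (a + 1 = 5 * y ∧ p = 0 ∧ q = y ∧ i' = 1 ∧ j' = 3 ∧ l = 0) ∨
  (a + 1 = 7 * y ∧ p = y ∧ q = y ∧ i = 1 ∧ j = 2 ∧ i' = 2 ∧ j' = 1 ∧ l = 0) ∨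
  (a + 1 = 7 * y ∧ p = y ∧ q = y ∧ i = 2 ∧ j = 1 ∧ i' = 1 ∧ j' = 2 ∧ l = 0) ∨
  (a + 1 = 9 * y ∧ p = y ∧ q = y ∧ i = 1 ∧ j = 1 ∧ i' = 3 ∧ j' = 1 ∧ l = 1) ∨
  (a + 1 = 25 * y ∧ p = y ∧ q = y ∧ i = 1 ∧ j = 3 ∧ i' = 5 ∧ j' = 3 ∧ l = 3) ∨
  (a + 1 = 11 * y ∧ p = 0 ∧ q = y ∧ i = 1 ∧ j = 3 ∧ i' = 1 ∧ j' = 1 ∧ l = 2) ∨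
  (a + 1 = 13 * y ∧ p = 0 ∧ q = y ∧ i = 1 ∧ j = 1 ∧ i' = 1 ∧ j' = 3 ∧ l = 4))

/-- The even exponents in `buSum a X`. -/
def XRowEven (a w p q i j i' j' l : ℕ) : Prop :=
  (a = 2 ∧ w = 2 ∧ p = 0 ∧ q = 0) ∨
  (a = 4 ∧ w = 2 ∧ p = 1 ∧ q = 0 ∧ i = 1 ∧ j = 1) ∨
  (a = 4 ∧ w = 2 ∧ p = 0 ∧ q = 1 ∧ i' = 1 ∧ j' = 1 ∧ l = 0) ∨
  (a = 6 ∧ w = 4 ∧ p = 1 ∧ q = 0 ∧ i = 1 ∧ j = 1) ∨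
  (a = 6 ∧ w = 4 ∧ p = 0 ∧ q = 1 ∧ i' = 1 ∧ j' = 1 ∧ l = 0) ∨
  (a = 8 ∧ w = 4 ∧ p = 1 ∧ q = 0 ∧ i = 1 ∧ j = 3) ∨
  (a = 8 ∧ w = 4 ∧ p = 0 ∧ q = 1 ∧ i' = 1 ∧ j' = 3 ∧ l = 0) ∨
  (a = 10 ∧ w = 2 ∧ p = 2 ∧ q = 1 ∧ i = 1 ∧ j = 1 ∧ i' = 1 ∧ j' = 3 ∧ l = 0) ∨
  (a = 14 ∧ w = 8 ∧ p = 1 ∧ q = 1 ∧ i = 1 ∧ j = 2 ∧ i' = 2 ∧ j' = 1 ∧ l = 0) ∨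
  (a = 14 ∧ w = 8 ∧ p = 1 ∧ q = 1 ∧ i = 2 ∧ j = 1 ∧ i' = 1 ∧ j' = 2 ∧ l = 0) ∨
  (a = 16 ∧ w = 8 ∧ p = 1 ∧ q = 1 ∧ i = 1 ∧ j = 1 ∧ i' = 3 ∧ j' = 1 ∧ l = 1) ∨
  (a = 20 ∧ w = 2 ∧ p = 2 ∧ q = 1 ∧ i = 1 ∧ j = 3 ∧ i' = 1 ∧ j' = 1 ∧ l = 2) ∨
  (a = 24 ∧ w = 4 ∧ p = 4 ∧ q = 1 ∧ i = 1 ∧ j = 1 ∧ i' = 1 ∧ j' = 3 ∧ l = 4)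

theorem Shape.cases {e w u α v β : ℕ} (h : Shape e w u α v β) :
    (∃ y, 0 < y ∧ (y = 2 ∨ y = 4 ∨ y = 8 ∨ 16 ∣ y) ∧ e + 1 = y * u ∧ w + 1 = y ∧ α = y ∧ v = 1 ∧ β = 1) ∨
    (∃ n y, 0 < y ∧ (y = 2 ∨ y = 4 ∨ y = 8 ∨ 16 ∣ y) ∧ e = 2 * n ∧ w = y ∧ α = 1 ∧ β = y ∧
      ((n = u ∧ n + 1 = y * v) ∨ (n = y * v ∧ n + 1 = u))) := by
  rcases h with ⟨s, hs, -, h⟩ | ⟨n, r, hr, -, -, h⟩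
  · exact Or.inl ⟨2 ^ s, by positivity, two_pow_cases hs, h⟩
  · exact Or.inr ⟨n, 2 ^ r, by positivity, two_pow_cases hr, h⟩

theorem GeoType.mem {u p q i j i' j' l : ℕ} (h : GeoType u p q i j i' j' l) :
    u = 1 ∨ u = 3 ∨ u = 5 ∨ u = 7 ∨ u = 9 ∨ u = 11 ∨ u = 13 ∨ u = 25 := by
  rcases h with h | h | h | h | h | h | h | h | h | h | h <;> simp [h.1]

/-- One of two consecutive integers is in the finite list of admissible odd values, and the other is
y times such a value; so n is bounded. -/
theorem even_shape_cases {n y u v : ℕ} (h0 : 0 < y) (hy : y = 2 ∨ y = 4 ∨ y = 8 ∨ 16 ∣ y)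
    (hn : (n = u ∧ n + 1 = y * v) ∨ (n = y * v ∧ n + 1 = u))
    (hu : u = 1 ∨ u = 3 ∨ u = 5 ∨ u = 7 ∨ u = 9 ∨ u = 11 ∨ u = 13 ∨ u = 25)
    (hv : v = 1 ∨ v = 3 ∨ v = 5 ∨ v = 7 ∨ v = 9 ∨ v = 11 ∨ v = 13 ∨ v = 25) :
    (u = 1 ∧ v = 1 ∧ y = 2 ∧ n = 1) ∨ (u = 3 ∧ v = 1 ∧ y = 2 ∧ n = 2) ∨
    (u = 3 ∧ v = 1 ∧ y = 4 ∧ n = 3) ∨ (u = 5 ∧ v = 1 ∧ y = 4 ∧ n = 4) ∨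
    (u = 5 ∧ v = 3 ∧ y = 2 ∧ n = 5) ∨ (u = 7 ∧ v = 3 ∧ y = 2 ∧ n = 6) ∨
    (u = 7 ∧ v = 1 ∧ y = 8 ∧ n = 7) ∨ (u = 9 ∧ v = 1 ∧ y = 8 ∧ n = 8) ∨
    (u = 9 ∧ v = 5 ∧ y = 2 ∧ n = 9) ∨ (u = 11 ∧ v = 5 ∧ y = 2 ∧ n = 10) ∨
    (u = 11 ∧ v = 3 ∧ y = 4 ∧ n = 11) ∨ (u = 13 ∧ v = 3 ∧ y = 4 ∧ n = 12) ∨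
    (u = 13 ∧ v = 7 ∧ y = 2 ∧ n = 13) ∨ (u = 25 ∧ v = 3 ∧ y = 8 ∧ n = 24) ∨
    (u = 25 ∧ v = 13 ∧ y = 2 ∧ n = 25) := by
  rcases hv with rfl | rfl | rfl | rfl | rfl | rfl | rfl | rfl <;>
  rcases hu with rfl | rfl | rfl | rfl | rfl | rfl | rfl | rfl <;>
  simp only [Nat.reduceEqDiff, OfNat.ofNat_ne_one, OfNat.one_ne_ofNat, false_and, true_and,
    or_false, false_or] <;>
  omega

theorem XSide.rows {a w p q i j i' j' l : ℕ} (H : XSide a w p q i j i' j' l)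
    (hle : l = 0 → i + j ≤ i' + j') :
    XRowOdd a w p q i j i' j' l ∨ XRowEven a w p q i j i' j' l := by
  obtain ⟨u, α, v, β, pu, qu, pv, qv, hS, hu, hv, rfl, rfl⟩ := H
  rcases hS.cases with ⟨y, h0, hy, ha, hw, rfl, rfl, rfl⟩ |
    ⟨n, y, h0, hy, rfl, hw, rfl, hβ, hn⟩
  · left
    obtain ⟨rfl, rfl⟩ : pv = 0 ∧ qv = 0 := by
      unfold GeoType at hv
      omega
    refine ⟨α, h0, hy, hw, ?_⟩
    simp only [zero_mul, add_zero]
    clear hS hv hy h0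
    rcases hu with h | h | h | h | h | h | h | h | h | h | h
    · exact Or.inl (by obtain ⟨rfl, rfl, rfl⟩ := h; omega)
    · exact Or.inr (Or.inl (by obtain ⟨rfl, rfl, rfl, h⟩ := h; omega))
    · exact Or.inr (Or.inr (Or.inl (by obtain ⟨rfl, rfl, rfl, h⟩ := h; omega)))
    · exact Or.inr (Or.inr (Or.inr (Or.inl (by obtain ⟨rfl, rfl, rfl, h⟩ := h; omega))))
    all_goals
      iterate 4 apply Or.inr
    · exact Or.inl (by obtain ⟨rfl, rfl, rfl, h⟩ := h; omega)
    · exact Or.inr (Or.inl (by obtain ⟨rfl, rfl, rfl, h⟩ := h; omega))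
    · exact Or.inr (Or.inr (Or.inl (by obtain ⟨rfl, rfl, rfl, h⟩ := h; omega)))
    · exact Or.inr (Or.inr (Or.inr (Or.inl (by obtain ⟨rfl, rfl, rfl, h⟩ := h; omega))))
    all_goals
      iterate 4 apply Or.inr
    · exact Or.inl (by obtain ⟨rfl, rfl, rfl, h⟩ := h; omega)
    · exact Or.inr (Or.inl (by obtain ⟨rfl, rfl, rfl, h⟩ := h; omega))
    · exact Or.inr (Or.inr (by obtain ⟨rfl, rfl, rfl, h⟩ := h; omega))
  · right
    subst hβ hw
    have hc := even_shape_cases h0 hy hn hu.mem hv.mem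
    clear hS hy hn h0
    unfold GeoType at hu hv
    unfold XRowEven
    rcases hc with h | h | h | h | h | h | h | h | h | h | h | h | h | h | h <;>
    obtain ⟨rfl, rfl, rfl, rfl⟩ := h <;>
    simp only [Nat.reduceEqDiff, Nat.reduceMul, OfNat.ofNat_ne_one, OfNat.one_ne_ofNat, false_and,
      true_and, or_false, false_or, mul_one] at hu hv ⊢ <;>
    omega

/-- Either no Q arises, or `geo (z + 1) P` is Q with z = 2^s. In the even shape with Q present, n
and n+1 are z+1 and a power of two: either n = z, or z = 2 and n = 3. -/
theorem PSide.rows {h w c i j i' j' l : ℕ} (H : PSide h w c i j i' j' l) (hi : 0 < i) :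
    (c = 0 ∧ w = h ∧ (h = 2 ∨ h + 1 = 2 ∨ h + 1 = 4 ∨ 8 ∣ h + 1)) ∨
    (l = 1 ∧ ∃ z, (z = 2 ∨ 4 ∣ z) ∧ 0 < z ∧ i' + i = z * i ∧ j' + j = z * j ∧
      ((2 ∣ c ∧ 0 < c ∧ (c = 2 → h = 2 * z + 1 ∧ w = 1)) ∨ (c = 1 ∧ h = 2 * z ∧ w = z) ∨
        (c = 1 ∧ h = 6 ∧ w = 4 ∧ z = 2))) := by
  obtain ⟨u, α, v, β, cu, cv, hS, hu, hv, rfl⟩ := H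
  have hP : ∀ {u c}, PGeoType u c i j i' j' l → (c = 0 ∧ u = 1) ∨ (c = 1 ∧ l = 1 ∧
      ∃ z, (z = 2 ∨ z = 4 ∨ z = 8 ∨ 16 ∣ z) ∧ 0 < z ∧ u = z + 1 ∧ i' + i = z * i ∧ j' + j = z * j) := by
    rintro u c (h | ⟨h1, h2, s, hs, h3⟩)
    · exact Or.inl h
    · exact Or.inr ⟨h1, h2, 2 ^ s, two_pow_cases hs, by positivity, h3⟩
  replace hu := hP hu
  replace hv := hP hv
  rcases hS.cases with ⟨y, h0, hy, ha, hw, rfl, rfl, rfl⟩ |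
    ⟨n, y, h0, hy, rfl, hw, rfl, hβ, hn⟩
  · have hcv : cv = 0 := by
      rcases hv with ⟨h, -⟩ | ⟨-, -, z, -, hz, h, -⟩
      · exact h
      · omega
    subst hcv
    rcases hu with ⟨rfl, rfl⟩ | ⟨rfl, rfl, z, hz, hz0, rfl, h1, h2⟩
    · left; omega
    · right
      refine ⟨rfl, z, by omega, hz0, h1, h2, Or.inl ⟨by omega, by omega, ?_⟩⟩
      intro h3
      have h4 : α = 2 := by omega
      subst h4
      omega
  · rcases hu with ⟨rfl, rfl⟩ | ⟨rfl, rfl, z, hz, hz0, rfl, h1, h2⟩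
    · rcases hv with ⟨rfl, rfl⟩ | ⟨rfl, rfl, z, hz, hz0, rfl, h1, h2⟩
      · left; omega
      -- With u = 1 the integer n is at most 1, too small for v = z + 1.
      · exfalso
        rcases hn with ⟨rfl, h3⟩ | ⟨h3, h4⟩
        · have : 2 * 2 ≤ y * (z + 1) := Nat.mul_le_mul (by omega) (by omega)
          omega
        · have : 0 < y * (z + 1) := Nat.mul_pos (by omega) (by omega)
          omega
    · right
      rcases hv with ⟨rfl, rfl⟩ | ⟨rfl, -, z', hz', -, rfl, h1', h2'⟩
      · refine ⟨rfl, z, by omega, hz0, h1, h2, ?_⟩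
        omega
      -- If both sums equal Q, then z' = z, and two consecutive integers would be z + 1 and y(z +
      -- 1).
      · exfalso
        obtain rfl : z = z' := Nat.eq_of_mul_eq_mul_right hi (h1.symm.trans h1')
        have h5 : 2 * (z + 1) ≤ y * (z + 1) := Nat.mul_le_mul_right _ (by omega)
        rcases hn with ⟨h3, h4⟩ | ⟨h3, h4⟩ <;> omega

/-- The list of exponents of the bi-unitary perfect polynomials
`X ^ a * (1 + X) ^ b * P ^ h * Q ^ k`. -/
def Solution (a b h k i j i' j' l : ℕ) : Prop :=
  (i = 1 ∧ j = 3 ∧ i' = 3 ∧ j' = 1 ∧ l = 0 ∧ ((a = 8 ∧ b = 8 ∧ h = 1 ∧ k = 1) ∨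
    (a = 8 ∧ b = 9 ∧ h = 1 ∧ k = 2) ∨ (a = 9 ∧ b = 8 ∧ h = 2 ∧ k = 1) ∨
    (a = 9 ∧ b = 9 ∧ h = 2 ∧ k = 2))) ∨
  (i = 3 ∧ j = 1 ∧ i' = 1 ∧ j' = 3 ∧ l = 0 ∧ ((a = 8 ∧ b = 8 ∧ h = 1 ∧ k = 1) ∨
    (a = 8 ∧ b = 9 ∧ h = 2 ∧ k = 1) ∨ (a = 9 ∧ b = 8 ∧ h = 1 ∧ k = 2) ∨
    (a = 9 ∧ b = 9 ∧ h = 2 ∧ k = 2))) ∨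
  (i = 1 ∧ j = 1 ∧ i' = 3 ∧ j' = 1 ∧ l = 0 ∧ a = 7 ∧ b = 10 ∧ h = 2 ∧ k = 1) ∨
  (i = 1 ∧ j = 1 ∧ i' = 1 ∧ j' = 3 ∧ l = 0 ∧ a = 10 ∧ b = 7 ∧ h = 2 ∧ k = 1) ∨
  (((i = 1 ∧ j = 2 ∧ i' = 2 ∧ j' = 1 ∧ l = 0) ∨ (i = 2 ∧ j = 1 ∧ i' = 1 ∧ j' = 2 ∧ l = 0)) ∧
    h = 2 ∧ k = 2 ∧ ((a = 7 ∧ b = 13) ∨ (a = 13 ∧ b = 7) ∨ (a = 14 ∧ b = 14))) ∨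
  (i = 1 ∧ j = 1 ∧ i' = 1 ∧ j' = 1 ∧ l = 1 ∧ ((a = 4 ∧ b = 5 ∧ h = 4 ∧ k = 1) ∨
    (a = 5 ∧ b = 4 ∧ h = 4 ∧ k = 1) ∨ (a = 4 ∧ b = 5 ∧ h = 5 ∧ k = 2) ∨
    (a = 5 ∧ b = 4 ∧ h = 5 ∧ k = 2)))

theorem XSide.q_type {a w p q i j i' j' l : ℕ} (H : XSide a w p q i j i' j' l) (hq : 0 < q) :
    (i' = 1 ∧ j' = 1 ∧ l = 0) ∨ (i' = 1 ∧ j' = 3 ∧ l = 0) ∨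
    (i = 1 ∧ j = 2 ∧ i' = 2 ∧ j' = 1 ∧ l = 0) ∨ (i = 2 ∧ j = 1 ∧ i' = 1 ∧ j' = 2 ∧ l = 0) ∨
    (i = 1 ∧ j = 1 ∧ i' = 3 ∧ j' = 1 ∧ l = 1) ∨ (i = 1 ∧ j = 3 ∧ i' = 5 ∧ j' = 3 ∧ l = 3) ∨
    (i = 1 ∧ j = 3 ∧ i' = 1 ∧ j' = 1 ∧ l = 2) ∨ (i = 1 ∧ j = 1 ∧ i' = 1 ∧ j' = 3 ∧ l = 4) := by
  obtain ⟨u, α, v, β, pu, qu, pv, qv, -, hu, hv, -, rfl⟩ := H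
  have h : qu ≠ 0 ∨ qv ≠ 0 := by
    by_contra! h
    simp [h.1, h.2] at hq
  unfold GeoType at hu hv
  rcases h with h0 | h0
  · rcases hu with h | h | h | h | h | h | h | h | h | h | h <;> first | (exfalso; omega) | simp [h]
  · rcases hv with h | h | h | h | h | h | h | h | h | h | h <;> first | (exfalso; omega) | simp [h]

theorem XSide.p_type {a w p q i j i' j' l : ℕ} (H : XSide a w p q i j i' j' l) (hp : 0 < p) :
    (i = 1 ∧ j = 1) ∨ (i = 1 ∧ j = 3) ∨ (i = 1 ∧ j = 2 ∧ l = 0) ∨ (i = 2 ∧ j = 1 ∧ l = 0) := by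
  obtain ⟨u, α, v, β, pu, qu, pv, qv, -, hu, hv, rfl, -⟩ := H
  have h : pu ≠ 0 ∨ pv ≠ 0 := by
    by_contra! h
    simp [h.1, h.2] at hp
  unfold GeoType at hu hv
  rcases h with h0 | h0
  · rcases hu with h | h | h | h | h | h | h | h | h | h | h <;> first | (exfalso; omega) | simp [h]
  · rcases hv with h | h | h | h | h | h | h | h | h | h | h <;> first | (exfalso; omega) | simp [h]

/-- A consequence of being a power of two, in linear arithmetic. -/
def PowLike (y : ℕ) : Prop := 0 < y ∧ (y = 2 ∨ y = 4 ∨ y % 8 = 0)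

/-- A consequence of being `2` or one less than a power of two, in linear arithmetic. -/
def ExpLike (k : ℕ) : Prop := k = 1 ∨ k = 2 ∨ k % 4 = 3

/-- The rows of `XRowOdd` and `XRowEven` in one list. -/
theorem XSide.list {a w p q i j i' j' l : ℕ} (H : XSide a w p q i j i' j' l)
    (hle : l = 0 → i + j ≤ i' + j') : ∃ y, PowLike y ∧
  ((w + 1 = y ∧ a + 1 = y ∧ p = 0 ∧ q = 0) ∨
  (w + 1 = y ∧ a + 1 = 3 * y ∧ p = y ∧ q = 0 ∧ i = 1 ∧ j = 1) ∨
  (w + 1 = y ∧ a + 1 = 3 * y ∧ p = 0 ∧ q = y ∧ i' = 1 ∧ j' = 1 ∧ l = 0) ∨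
  (w + 1 = y ∧ a + 1 = 5 * y ∧ p = y ∧ q = 0 ∧ i = 1 ∧ j = 3) ∨
  (w + 1 = y ∧ a + 1 = 5 * y ∧ p = 0 ∧ q = y ∧ i' = 1 ∧ j' = 3 ∧ l = 0) ∨
  (w + 1 = y ∧ a + 1 = 7 * y ∧ p = y ∧ q = y ∧ i = 1 ∧ j = 2 ∧ i' = 2 ∧ j' = 1 ∧ l = 0) ∨
  (w + 1 = y ∧ a + 1 = 7 * y ∧ p = y ∧ q = y ∧ i = 2 ∧ j = 1 ∧ i' = 1 ∧ j' = 2 ∧ l = 0) ∨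
  (w + 1 = y ∧ a + 1 = 9 * y ∧ p = y ∧ q = y ∧ i = 1 ∧ j = 1 ∧ i' = 3 ∧ j' = 1 ∧ l = 1) ∨
  (w + 1 = y ∧ a + 1 = 25 * y ∧ p = y ∧ q = y ∧ i = 1 ∧ j = 3 ∧ i' = 5 ∧ j' = 3 ∧ l = 3) ∨
  (w + 1 = y ∧ a + 1 = 11 * y ∧ p = 0 ∧ q = y ∧ i = 1 ∧ j = 3 ∧ i' = 1 ∧ j' = 1 ∧ l = 2) ∨
  (w + 1 = y ∧ a + 1 = 13 * y ∧ p = 0 ∧ q = y ∧ i = 1 ∧ j = 1 ∧ i' = 1 ∧ j' = 3 ∧ l = 4) ∨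
  XRowEven a w p q i j i' j' l) := by
  rcases H.rows hle with ⟨y, h0, h1, h2, h3⟩ | h
  · refine ⟨y, ⟨h0, by omega⟩, ?_⟩
    rcases h3 with h | h | h | h | h | h | h | h | h | h | h <;> simp [h, h2]
  · exact ⟨2, ⟨by omega, by omega⟩, by simp only [h, or_true]⟩

set_option maxHeartbeats 4000000 in
-- The dichotomy is whether σ**(P^h) contributes a factor Q. If not, Q must come from the x and x+1
-- sides, which restricts the type of (P, Q) to a finite list; if so, l = 1 and all of Q comes from
-- P. For each type the rows of the tables make the equations linear.
theorem solution_of_eqs {a b h k i j i' j' l wa wb wh wk pa qa pb qb c : ℕ}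
    (ha : XSide a wa pa qa i j i' j' l) (hb : XSide b wb pb qb j i j' i' l)
    (hh : PSide h wh c i j i' j' l) (hwk : wk = k) (hk : ExpLike k)
    (ea : a = wb + i * wh + i' * wk) (eb : b = wa + j * wh + j' * wk)
    (eh : h = pa + pb + l * wk) (ek : k = qa + qb + c)
    (hi : 0 < i) (h0 : 0 < h) (k0 : 0 < k)
    (hle : l = 0 → i + j ≤ i' + j') (hne : l = 0 → ¬ (i = i' ∧ j = j')) :
    Solution a b h k i j i' j' l := by
  subst hwk
  have qa' := ha.q_type
  have qb' := hb.q_type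
  have pa' := ha.p_type
  have pb' := hb.p_type
  obtain ⟨y, hy, la⟩ := ha.list hle
  obtain ⟨y', hy', lb⟩ := hb.list (by omega)
  rcases hh.rows hi with ⟨rfl, rfl, hr⟩ | ⟨rfl, z, hz, hz0, hi', hj', hr⟩
  · have ht : (i = 1 ∧ j = 1 ∧ i' = 1 ∧ j' = 3 ∧ l = 0) ∨ (i = 1 ∧ j = 1 ∧ i' = 3 ∧ j' = 1 ∧ l = 0) ∨
        (i = 1 ∧ j = 3 ∧ i' = 3 ∧ j' = 1 ∧ l = 0) ∨ (i = 3 ∧ j = 1 ∧ i' = 1 ∧ j' = 3 ∧ l = 0) ∨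
        (i = 1 ∧ j = 2 ∧ i' = 1 ∧ j' = 3 ∧ l = 0) ∨ (i = 2 ∧ j = 1 ∧ i' = 1 ∧ j' = 3 ∧ l = 0) ∨
        (i = 1 ∧ j = 2 ∧ i' = 3 ∧ j' = 1 ∧ l = 0) ∨ (i = 2 ∧ j = 1 ∧ i' = 3 ∧ j' = 1 ∧ l = 0) ∨
        (i = 1 ∧ j = 2 ∧ i' = 2 ∧ j' = 1 ∧ l = 0) ∨ (i = 2 ∧ j = 1 ∧ i' = 1 ∧ j' = 2 ∧ l = 0) ∨
        (i = 1 ∧ j = 1 ∧ i' = 3 ∧ j' = 1 ∧ l = 1) ∨ (i = 1 ∧ j = 1 ∧ i' = 1 ∧ j' = 3 ∧ l = 1) ∨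
        (i = 1 ∧ j = 3 ∧ i' = 5 ∧ j' = 3 ∧ l = 3) ∨ (i = 3 ∧ j = 1 ∧ i' = 3 ∧ j' = 5 ∧ l = 3) ∨
        (i = 1 ∧ j = 3 ∧ i' = 1 ∧ j' = 1 ∧ l = 2) ∨ (i = 3 ∧ j = 1 ∧ i' = 1 ∧ j' = 1 ∧ l = 2) ∨
        (i = 1 ∧ j = 1 ∧ i' = 1 ∧ j' = 3 ∧ l = 4) ∨ (i = 1 ∧ j = 1 ∧ i' = 3 ∧ j' = 1 ∧ l = 4) := by
      have hq : 0 < qa ∨ 0 < qb := by omega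
      clear la lb ea eb hr hk
      by_cases hl : l = 0
      · subst hl
        have hp : 0 < pa ∨ 0 < pb := by omega
        have hle := hle rfl
        have hne := hne rfl
        clear eh ek
        rcases hq with hq | hq
        · replace qa' := qa' hq
          clear qb'
          rcases hp with hp | hp
          · replace pa' := pa' hp
            clear pb'
            rcases qa' with h | h | h | h | h | h | h | h <;> rcases pa' with h' | h' | h' | h' <;>
              first | (exfalso; omega) | simp [h, h']
          · replace pb' := pb' hp
            clear pa'
            rcases qa' with h | h | h | h | h | h | h | h <;> rcases pb' with h' | h' | h' | h' <;>
              first | (exfalso; omega) | simp [h, h']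
        · replace qb' := qb' hq
          clear qa'
          rcases hp with hp | hp
          · replace pa' := pa' hp
            clear pb'
            rcases qb' with h | h | h | h | h | h | h | h <;> rcases pa' with h' | h' | h' | h' <;>
              first | (exfalso; omega) | simp [h, h']
          · replace pb' := pb' hp
            clear pa'
            rcases qb' with h | h | h | h | h | h | h | h <;> rcases pb' with h' | h' | h' | h' <;>
              first | (exfalso; omega) | simp [h, h']
      · clear pa' pb' eh ek
        rcases hq with hq | hq
        · rcases qa' hq with h | h | h | h | h | h | h | h <;> first | (exfalso; omega) | simp [h]
        · rcases qb' hq with h | h | h | h | h | h | h | h <;> first | (exfalso; omega) | simp [h]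
    have hh' : ExpLike wh := by
      clear la lb
      unfold ExpLike
      omega
    clear qa' qb' pa' pb' ha hb hle hne hh hr
    unfold XRowEven at la lb
    unfold Solution
    rcases ht with h | h | h | h | h | h | h | h | h | h | h | h | h | h | h | h | h | h
    all_goals
      obtain ⟨rfl, rfl, rfl, rfl, rfl⟩ := h
      simp only [Nat.reduceEqDiff, OfNat.ofNat_ne_one, OfNat.one_ne_ofNat, OfNat.zero_ne_ofNat,
        zero_ne_one, and_true, and_false, true_and, false_and,
        or_false, false_or] at la lb ⊢
      casesm* _ ∨ _
      all_goals
        -- Now k is a sum of two terms, each 0, 1 or a power of two; if it is 3 modulo 4, it can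
        -- only be 2 + 1.
        have hk3 : wk ≤ 3 := by
          clear ea eb eh hh'
          unfold ExpLike at hk
          unfold PowLike at hy hy'
          omega
        unfold ExpLike at hh'
        unfold PowLike at hy hy'
        interval_cases wk
        all_goals first | (exfalso; omega) | omega
  -- With l = 1 a factor Q on the x side means (i, j, i', j') = (1, 1, 3, 1), which contradicts i' +
  -- i = zi, j' + j = zj.
  · have hqa : qa = 0 := by
      by_contra h1
      clear la lb ea eb eh
      rcases qa' (by omega) with h | h | h | h | h | h | h | h <;> first
      | (exfalso; omega)
      | (obtain ⟨rfl, rfl, h⟩ := h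
         omega)
    have hqb : qb = 0 := by
      by_contra h1
      clear la lb ea eb eh
      rcases qb' (by omega) with h | h | h | h | h | h | h | h <;> first
      | (exfalso; omega)
      | (obtain ⟨rfl, rfl, h⟩ := h
         omega)
    subst hqa hqb
    have hh'' : (c = 2 ∧ h = 2 * z + 1 ∧ wh = 1) ∨ (c = 1 ∧ h = 2 * z ∧ wh = z) ∨
        (c = 1 ∧ h = 6 ∧ wh = 4 ∧ z = 2) := by
      rcases hr with hr | hr | hr
      -- Here c = k is positive and even, and the only even value allowed by `ExpLike` is 2.
      · have : c = 2 := by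
          clear la lb qa' qb' pa' pb'
          unfold ExpLike at hk
          omega
        exact Or.inl ⟨this, hr.2.2 this⟩
      · exact Or.inr (Or.inl hr)
      · exact Or.inr (Or.inr hr)
    clear hr hk hh
    have hp : 0 < pa ∨ 0 < pb := by
      clear la lb qa' qb' pa' pb'
      omega
    have ht : (i = 1 ∧ j = 1) ∨ (i = 1 ∧ j = 3) ∨ (i = 3 ∧ j = 1) := by
      clear la lb qa' qb' ea eb hh''
      rcases hp with hp | hp
      · have := pa' hp
        clear pa' pb'
        omega
      · have := pb' hp
        clear pa' pb'
        omega
    clear qa' qb' pa' pb' ha hb hle hne hp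
    unfold XRowEven at la lb
    unfold Solution
    obtain rfl : wk = c := by clear la lb; omega
    rcases ht with h | h | h <;>
    rcases hh'' with ⟨rfl, rfl, rfl⟩ | ⟨rfl, rfl, rfl⟩ | ⟨rfl, rfl, rfl, rfl⟩
    all_goals
      obtain ⟨rfl, rfl⟩ := h
      simp only [Nat.reduceEqDiff, OfNat.ofNat_ne_one, OfNat.one_ne_ofNat,
        zero_ne_one, one_ne_zero, and_true, and_false, true_and, false_and,
        or_false, false_or] at la lb ⊢
      casesm* _ ∨ _
      all_goals
        unfold PowLike at hy hy'
        first | (exfalso; omega) | omega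

/-! ### Geometric sums at P and Q -/

theorem derivative_ne_zero {T : (ZMod 2)[X]} (hT : Irreducible T) : derivative T ≠ 0 :=
  (separable_iff_derivative_ne_zero hT).1 (PerfectField.separable_of_irreducible hT)

theorem one_add_irreducible_ne_zero {T : (ZMod 2)[X]} (hT : Irreducible T) : 1 + T ≠ 0 :=
  one_add_ne_zero hT.natDegree_pos

theorem isCoprime_geo_self_of_odd {u : ℕ} (hu : Odd u) (T : (ZMod 2)[X]) :
    IsCoprime (geo u T) T := by
  obtain ⟨m, rfl⟩ := hu
  exact isCoprime_geo_self _ _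

/-- Differentiating R^(c+1)(1 + T) = 1 + T^u shows that R^c divides T^(u-1)T'. Since R is coprime to
T, R^c divides T', which is nonzero and of smaller degree than T. -/
theorem natDegree_mul_lt_of_geo_eq_pow {T R : (ZMod 2)[X]} (hT : Irreducible T)
    {u c : ℕ} (hu : Odd u) (h : geo u T = R ^ (c + 1)) :
    c * R.natDegree < T.natDegree := by
  have hd := congrArg derivative (h ▸ geo_mul_one_add u T)
  have hu1 : (u : ZMod 2) = 1 := by
    obtain ⟨m, rfl⟩ := hu
    have h2 : (2 : ZMod 2) = 0 := by decide
    push_cast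
    rw [h2]; simp
  simp only [derivative_mul, derivative_add, derivative_one, zero_add, derivative_pow, hu1,
    C_1, one_mul, Nat.add_sub_cancel] at hd
  have h1 : R ^ c ∣ T ^ (u - 1) * derivative T := by
    rw [← hd]
    exact ⟨C (((c + 1 : ℕ) : ZMod 2)) * derivative R * (1 + T) + R * derivative T, by ring⟩
  have h2 : IsCoprime (R ^ c) (T ^ (u - 1)) := by
    have h3 : IsCoprime (R ^ (c + 1)) T := h ▸ isCoprime_geo_self_of_odd hu T
    exact (IsCoprime.pow_left_iff (Nat.succ_pos c)).1 h3 |>.pow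
  have h3 := natDegree_le_of_dvd (h2.dvd_of_dvd_mul_left h1) (derivative_ne_zero hT)
  rw [natDegree_pow] at h3
  exact h3.trans_lt (natDegree_derivative_lt hT.natDegree_pos.ne')

/-- For u ≥ 3 the sum has degree at least 2 deg Q, while the derivative bound gives c·deg P < deg Q
+ deg P ≤ 2 deg Q. -/
theorem OddPair.eq_one_of_geo_Q {P Q : (ZMod 2)[X]} {i j i' j' l u c : ℕ}
    (H : OddPair P Q i j i' j' l) (hu : Odd u) (h : geo u Q = P ^ c) : u = 1 := by
  have hd := congrArg natDegree h
  rw [natDegree_geo _ H.irrQ.natDegree_pos, natDegree_pow] at hd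
  have hQ := H.irrQ.natDegree_pos
  have hle := H.deg_le
  by_contra hu1
  obtain ⟨m, rfl⟩ := hu
  have hm : 2 * Q.natDegree ≤ (2 * m + 1 - 1) * Q.natDegree := Nat.mul_le_mul_right _ (by omega)
  rcases c with _ | c
  · omega
  · have := natDegree_mul_lt_of_geo_eq_pow H.irrQ ⟨m, rfl⟩ h
    rw [add_mul] at hd
    omega

/-- The derivative bound and deg P ≤ deg Q exclude c ≥ 2. For c = 1, 1 + Q = P(1+P)^(2^s-1) · `geo t
P`^(2^s), and comparison with the given factorization yields l = 1 and t = 1. -/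
theorem OddPair.pGeoType {P Q : (ZMod 2)[X]} {i j i' j' l u c : ℕ}
    (H : OddPair P Q i j i' j' l) (hu : Odd u) (h : geo u P = Q ^ c) :
    PGeoType u c i j i' j' l := by
  have hd := congrArg natDegree h
  rw [natDegree_geo _ H.irrP.natDegree_pos, natDegree_pow] at hd
  have hP := H.irrP.natDegree_pos
  have hQ := H.irrQ.natDegree_pos
  have hle := H.deg_le
  rcases c with _ | _ | c
  · left
    rw [zero_mul] at hd
    have := (Nat.mul_eq_zero.1 hd).resolve_right hP.ne'
    have := hu.pos
    exact ⟨rfl, by omega⟩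
  · right
    have hu1 : u ≠ 1 := by
      rintro rfl
      omega
    obtain ⟨s, t, hs, ht, rfl, hst⟩ := one_add_geo hu hu1
    have h1P := one_add_irreducible_ne_zero H.irrP
    have h1 := hst P h1P
    rw [h, zero_add, pow_one, H.eqQ, H.eqP] at h1
    have hc := isCoprime_geo_one_add ht h1P
    rw [H.eqP] at hc
    have hodd : Odd' (geo t P) :=
      ⟨hc.of_mul_right_left.of_isCoprime_of_dvd_right (dvd_pow_self _ H.hi.ne'),
        hc.of_mul_right_right.of_isCoprime_of_dvd_right (dvd_pow_self _ H.hj.ne')⟩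
    have hPt : ¬ P ∣ geo t P ^ 2 ^ s := fun h' => H.irrP.not_isUnit
      ((isCoprime_geo_self_of_odd ht P).pow_left.isUnit_of_dvd' h' dvd_rfl)
    obtain ⟨h2, h3, h4⟩ := X_pow_mul_cancel (R := P ^ l) (R' := P * geo t P ^ 2 ^ s)
      (H.oddP.pow l) (H.oddP.mul (hodd.pow _)) (a := i') (b := j')
      (a' := i * (2 ^ s - 1)) (b' := j * (2 ^ s - 1))
      (by rw [h1, mul_pow, ← pow_mul, ← pow_mul]; ring)
    obtain ⟨h5, h6⟩ := pow_mul_cancel (m := l) (n := 1) H.irrP (R := 1)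
      (fun h' => H.irrP.not_isUnit (isUnit_of_dvd_one h')) hPt
      (by rw [mul_one, pow_one]; exact h4)
    have h7 := congrArg natDegree h6
    rw [natDegree_one, natDegree_pow, natDegree_geo _ hP] at h7
    have h8 : t = 1 := by
      have h9 := (Nat.mul_eq_zero.1 h7.symm).resolve_left (by positivity)
      have := (Nat.mul_eq_zero.1 h9).resolve_right hP.ne'
      have := ht.pos
      omega
    have h9 : ∀ i : ℕ, i * (2 ^ s - 1) + i = 2 ^ s * i := by
      intro i
      rw [← Nat.mul_succ, Nat.succ_eq_add_one, Nat.sub_add_cancel Nat.one_le_two_pow, mul_comm]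
    exact ⟨rfl, h5, s, hs, by rw [h8, mul_one], by rw [h2, h9], by rw [h3, h9]⟩
  · exfalso
    have := natDegree_mul_lt_of_geo_eq_pow H.irrP hu h
    rw [add_mul] at this
    omega

/-! ### The substitution x ↦ x + 1 -/

theorem one_add_X_comp : (1 + X : (ZMod 2)[X]).comp (1 + X) = X := by
  rw [add_comp, one_comp, X_comp, ← add_assoc, add_self', zero_add]

theorem comp_comp_one_add_X (T : (ZMod 2)[X]) : (T.comp (1 + X)).comp (1 + X) = T := by
  rw [comp_assoc, one_add_X_comp, comp_X]

/-- The automorphism `T(x) ↦ T(x + 1)`. -/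
noncomputable def barEquiv : (ZMod 2)[X] ≃* (ZMod 2)[X] where
  toFun T := T.comp (1 + X)
  invFun T := T.comp (1 + X)
  left_inv := comp_comp_one_add_X
  right_inv := comp_comp_one_add_X
  map_mul' S T := mul_comp S T (1 + X)

theorem irreducible_comp {T : (ZMod 2)[X]} (h : Irreducible T) : Irreducible (T.comp (1 + X)) :=
  (MulEquiv.irreducible_iff barEquiv).2 h

theorem isCoprime_comp {S T : (ZMod 2)[X]} (h : IsCoprime S T) :
    IsCoprime (S.comp (1 + X)) (T.comp (1 + X)) :=
  h.map (compRingHom (1 + X))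

theorem Odd'.comp {S : (ZMod 2)[X]} (h : Odd' S) : Odd' (S.comp (1 + X)) := by
  have h1 := isCoprime_comp h.1
  have h2 := isCoprime_comp h.2
  rw [X_comp] at h1
  rw [one_add_X_comp] at h2
  exact ⟨h2, h1⟩

theorem OddPair.comp {P Q : (ZMod 2)[X]} {i j i' j' l : ℕ} (H : OddPair P Q i j i' j' l) :
    OddPair (P.comp (1 + X)) (Q.comp (1 + X)) j i j' i' l where
  irrP := irreducible_comp H.irrP
  irrQ := irreducible_comp H.irrQ
  ne h := H.ne (barEquiv.injective h)
  oddP := H.oddP.comp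
  oddQ := H.oddQ.comp
  eqP := by
    have := congrArg (fun T => T.comp (1 + X)) H.eqP
    simp only [add_comp, one_comp, mul_comp, pow_comp, X_comp, ← add_assoc, add_self', zero_add]
      at this
    rw [this, mul_comm]
  eqQ := by
    have := congrArg (fun T => T.comp (1 + X)) H.eqQ
    simp only [add_comp, one_comp, mul_comp, pow_comp, X_comp, ← add_assoc, add_self', zero_add]
      at this
    rw [this]; ring
  deg_le := by
    rw [natDegree_comp, natDegree_comp, natDegree_one_add_X, mul_one, mul_one]
    exact H.deg_le
  hi := H.hj
  hj := H.hi
  hi' := H.hj'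
  hj' := H.hi'

/-! ### From σ**(A) = A to the exponent equations -/

theorem dvd_of_odd_of_dvd {D R : (ZMod 2)[X]} (hD : Odd' D) {a b : ℕ}
    (h : D ∣ X ^ a * (1 + X) ^ b * R) : D ∣ R :=
  (hD.1.pow_right.mul_right hD.2.pow_right).dvd_of_dvd_mul_left h

theorem dvd_pow_mul_pow {P Q D : (ZMod 2)[X]} (hP : Irreducible P) (hQ : Irreducible Q) {h k : ℕ}
    (hD : D ∣ P ^ h * Q ^ k) : ∃ p q, D = P ^ p * Q ^ q := by
  obtain ⟨A, B, hA, hB, rfl⟩ := exists_dvd_and_dvd_of_dvd_mul hD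
  obtain ⟨p, -, hp⟩ := (dvd_prime_pow hP.prime h).1 hA
  obtain ⟨q, -, hq⟩ := (dvd_prime_pow hQ.prime k).1 hB
  exact ⟨p, q, by rw [eq_of_associated hp, eq_of_associated hq]⟩

theorem OddPair.exists_geoType {P Q : (ZMod 2)[X]} {i j i' j' l u a b h k : ℕ}
    (H : OddPair P Q i j i' j' l) (hu : Odd u)
    (hd : geo u X ∣ X ^ a * (1 + X) ^ b * (P ^ h * Q ^ k)) :
    ∃ p q, geo u X = P ^ p * Q ^ q ∧ GeoType u p q i j i' j' l := by
  obtain ⟨p, q, hpq⟩ := dvd_pow_mul_pow H.irrP H.irrQ (dvd_of_odd_of_dvd (odd_geo_X hu) hd)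
  have hsq := squarefree_geo_X hu
  rw [hpq] at hsq
  have key : ∀ {R : (ZMod 2)[X]} {n : ℕ}, Irreducible R → R ^ n ∣ P ^ p * Q ^ q → n ≤ 1 := by
    intro R n hR h
    by_contra hn
    exact hR.not_isUnit (hsq R (((pow_two R).symm ▸ pow_dvd_pow R (by omega : 2 ≤ n)).trans h))
  exact ⟨p, q, hpq, H.geoType hu (key H.irrP (Dvd.intro _ rfl)) (key H.irrQ (Dvd.intro_left _ rfl))
    hpq⟩

/-- The substitution x ↦ x+1 turns the base 1 + x into x and exchanges the roles of i, i' with j,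
j'. -/
theorem OddPair.exists_geoType_comp {P Q : (ZMod 2)[X]} {i j i' j' l u a b h k : ℕ}
    (H : OddPair P Q i j i' j' l) (hu : Odd u)
    (hd : geo u (1 + X) ∣ X ^ a * (1 + X) ^ b * (P ^ h * Q ^ k)) :
    ∃ p q, geo u (1 + X) = P ^ p * Q ^ q ∧ GeoType u p q j i j' i' l := by
  have h1 := map_dvd (compRingHom (1 + X)) hd
  simp only [coe_compRingHom_apply, geo_comp, mul_comp, pow_comp, X_comp, one_add_X_comp] at h1
  rw [mul_comm ((1 + X) ^ a)] at h1
  obtain ⟨p, q, hpq, ht⟩ := H.comp.exists_geoType hu h1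
  refine ⟨p, q, ?_, ht⟩
  have := congrArg (fun T => T.comp (1 + X)) hpq
  simpa only [geo_comp, mul_comp, pow_comp, X_comp, comp_comp_one_add_X] using this

theorem Shape.eq_of_one {k w α v β u : ℕ} (h : Shape k w u α v β) (hu : u = 1) (hv : v = 1) :
    w = k ∧ ExpLike k := by
  subst hu hv
  unfold ExpLike
  rcases h.cases with ⟨y, h0, hy, h1, h2, -⟩ | ⟨n, y, h0, hy, h1, h2, -, -, h3⟩
  · omega
  · omega

theorem OddPair.solution {P Q : (ZMod 2)[X]} {i j i' j' l a b h k : ℕ}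
    (H : OddPair P Q i j i' j' l) (ha : 0 < a) (hb : 0 < b) (hh : 0 < h) (hk : 0 < k)
    (heq : buSum a X * buSum b (1 + X) * buSum h P * buSum k Q =
      X ^ a * (1 + X) ^ b * (P ^ h * Q ^ k)) :
    Solution a b h k i j i' j' l := by
  obtain ⟨wa, ua, αa, va, βa, sa, fa⟩ := exists_shape ha
  obtain ⟨wb, ub, αb, vb, βb, sb, fb⟩ := exists_shape hb
  obtain ⟨wh, uh, αh, vh, βh, sh, fh⟩ := exists_shape hh
  obtain ⟨wk, uk, αk, vk, βk, sk, fk⟩ := exists_shape hk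
  have e11 : 1 + (1 + X) = (X : (ZMod 2)[X]) := by rw [← add_assoc, add_self', zero_add]
  have h1P := one_add_irreducible_ne_zero H.irrP
  have h1Q := one_add_irreducible_ne_zero H.irrQ
  rw [fa X one_add_X_ne_zero, fb (1 + X) (by rw [e11]; exact X_ne_zero), fh P h1P, fk Q h1Q,
    e11] at heq
  obtain ⟨oua, ova, αa0, βa0⟩ := sa.odd
  obtain ⟨oub, ovb, αb0, βb0⟩ := sb.odd
  obtain ⟨ouh, ovh, αh0, βh0⟩ := sh.odd
  obtain ⟨ouk, ovk, αk0, βk0⟩ := sk.odd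
  set R : (ZMod 2)[X] := X ^ a * (1 + X) ^ b * (P ^ h * Q ^ k) with hR
  have dua : geo ua X ∣ R := heq ▸ (((dvd_pow_self _ αa0.ne').mul_left _).mul_right _
    |>.mul_right _ |>.mul_right _ |>.mul_right _)
  have dva : geo va X ∣ R := heq ▸ ((dvd_pow_self _ βa0.ne').mul_left _
    |>.mul_right _ |>.mul_right _ |>.mul_right _)
  have dub : geo ub (1 + X) ∣ R := heq ▸ ((((dvd_pow_self _ αb0.ne').mul_left _).mul_right _
    |>.mul_left _) |>.mul_right _ |>.mul_right _)
  have dvb : geo vb (1 + X) ∣ R := heq ▸ (((dvd_pow_self _ βb0.ne').mul_left _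
    |>.mul_left _) |>.mul_right _ |>.mul_right _)
  have duh : geo uh P ∣ R := heq ▸ ((((dvd_pow_self _ αh0.ne').mul_left _).mul_right _
    |>.mul_left _) |>.mul_right _)
  have dvh : geo vh P ∣ R := heq ▸ (((dvd_pow_self _ βh0.ne').mul_left _
    |>.mul_left _) |>.mul_right _)
  have duk : geo uk Q ∣ R := heq ▸ (((dvd_pow_self _ αk0.ne').mul_left _).mul_right _
    |>.mul_left _)
  have dvk : geo vk Q ∣ R := heq ▸ ((dvd_pow_self _ βk0.ne').mul_left _ |>.mul_left _)
  obtain ⟨pua, qua, eua, tua⟩ := H.exists_geoType oua dua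
  obtain ⟨pva, qva, eva, tva⟩ := H.exists_geoType ova dva
  obtain ⟨pub, qub, eub, tub⟩ := H.exists_geoType_comp oub dub
  obtain ⟨pvb, qvb, evb, tvb⟩ := H.exists_geoType_comp ovb dvb
  have oddP : ∀ {u}, Odd u → Odd' (geo u P) := fun hu => by
    have hc := isCoprime_geo_one_add hu h1P
    rw [H.eqP] at hc
    exact ⟨hc.of_mul_right_left.of_isCoprime_of_dvd_right (dvd_pow_self _ H.hi.ne'),
      hc.of_mul_right_right.of_isCoprime_of_dvd_right (dvd_pow_self _ H.hj.ne')⟩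
  have oddQ : ∀ {u}, Odd u → Odd' (geo u Q) := fun hu => by
    have hc := isCoprime_geo_one_add hu h1Q
    rw [H.eqQ] at hc
    exact ⟨hc.of_mul_right_left.of_mul_right_left.of_isCoprime_of_dvd_right
        (dvd_pow_self _ H.hi'.ne'),
      hc.of_mul_right_left.of_mul_right_right.of_isCoprime_of_dvd_right
        (dvd_pow_self _ H.hj'.ne')⟩
  have powQ : ∀ {u}, Odd u → geo u P ∣ R → ∃ c, geo u P = Q ^ c ∧ PGeoType u c i j i' j' l := by
    intro u hu hd
    have h1 := dvd_of_odd_of_dvd (oddP hu) hd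
    have h2 := (isCoprime_geo_self_of_odd hu P).pow_right.dvd_of_dvd_mul_left h1
    obtain ⟨c, -, hc⟩ := (dvd_prime_pow H.irrQ.prime k).1 h2
    exact ⟨c, eq_of_associated hc, H.pGeoType hu (eq_of_associated hc)⟩
  have powP : ∀ {u}, Odd u → geo u Q ∣ R → u = 1 := by
    intro u hu hd
    have h1 := dvd_of_odd_of_dvd (oddQ hu) hd
    have h2 := (isCoprime_geo_self_of_odd hu Q).pow_right.dvd_of_dvd_mul_right h1
    obtain ⟨c, -, hc⟩ := (dvd_prime_pow H.irrP.prime h).1 h2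
    exact H.eq_one_of_geo_Q hu (eq_of_associated hc)
  obtain ⟨cu, ecu, tcu⟩ := powQ ouh duh
  obtain ⟨cv, ecv, tcv⟩ := powQ ovh dvh
  have huk := powP ouk duk
  have hvk := powP ovk dvk
  obtain ⟨hwk, hk2⟩ := sk.eq_of_one huk hvk
  rw [eua, eva, eub, evb, ecu, ecv, huk, hvk, geo_one, one_pow, one_pow, mul_one, mul_one,
    H.eqP, H.eqQ, hR] at heq
  -- The base x feeds powers of 1 + x and conversely; the powers of 1 + P and 1 + Q are spread over
  -- x, 1 + x and P.
  have heq' : X ^ (wb + i * wh + i' * wk) * (1 + X) ^ (wa + j * wh + j' * wk) *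
      (P ^ (pua * αa + pva * βa + (pub * αb + pvb * βb) + l * wk) *
        Q ^ (qua * αa + qva * βa + (qub * αb + qvb * βb) + (cu * αh + cv * βh))) =
      X ^ a * (1 + X) ^ b * (P ^ h * Q ^ k) := by
    rw [← heq]
    simp only [mul_pow, ← pow_mul, pow_add]
    ring
  obtain ⟨ea, eb, ec⟩ := X_pow_mul_cancel ((H.oddP.pow _).mul (H.oddQ.pow _))
    ((H.oddP.pow _).mul (H.oddQ.pow _)) heq'
  have hPQ : ∀ n, ¬ P ∣ Q ^ n := fun n hn => H.ne
    (eq_of_associated (H.irrP.associated_of_dvd H.irrQ (H.irrP.prime.dvd_of_dvd_pow hn)))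
  obtain ⟨eh, eq⟩ := pow_mul_cancel H.irrP (hPQ _) (hPQ _) ec
  have ek := pow_injective_of_not_isUnit H.irrQ.not_isUnit H.irrQ.ne_zero eq
  have hle := H.deg_le
  rw [H.natDegree_P, H.natDegree_Q] at hle
  refine solution_of_eqs (wa := wa) (wb := wb) (wh := wh) (wk := wk)
    ⟨ua, αa, va, βa, _, _, _, _, sa, tua, tva, rfl, rfl⟩
    ⟨ub, αb, vb, βb, _, _, _, _, sb, tub, tvb, rfl, rfl⟩
    ⟨uh, αh, vh, βh, _, _, sh, tcu, tcv, rfl⟩ hwk hk2 ea.symm eb.symm eh.symm ek.symm H.hi hh hk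
    ?_ ?_
  · rintro rfl
    simpa using hle
  · rintro rfl ⟨rfl, rfl⟩
    apply H.ne
    have := H.eqP.trans (H.eqQ.trans (by rw [pow_zero, mul_one])).symm
    exact add_left_cancel this

/-! ### Shape of a bi-unitary perfect polynomial with four prime factors -/

theorem X_dvd_one_add {T : (ZMod 2)[X]} (h : ¬ X ∣ T) : X ∣ 1 + T := by
  rw [X_dvd_iff] at h ⊢
  rw [coeff_add, coeff_one_zero]
  generalize T.coeff 0 = r at h
  revert r; decide

theorem one_add_X_dvd_iff {T : (ZMod 2)[X]} : 1 + X ∣ T ↔ T.eval 1 = 0 := by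
  rw [← IsRoot.def, ← dvd_iff_isRoot, C_1, CharTwo.sub_eq_add, add_comm]

theorem one_add_X_dvd_one_add {T : (ZMod 2)[X]} (h : ¬ (1 + X) ∣ T) : 1 + X ∣ 1 + T := by
  rw [one_add_X_dvd_iff] at h ⊢
  rw [eval_add, eval_one]
  generalize T.eval 1 = r at h
  revert r; decide

theorem odd_of_irreducible {T : (ZMod 2)[X]} (hT : Irreducible T) (h1 : T ≠ X) (h2 : T ≠ 1 + X) :
    Odd' T := by
  have key : ∀ {L : (ZMod 2)[X]}, Irreducible L → T ≠ L → IsCoprime T L := fun hL h =>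
    (hT.coprime_iff_not_dvd.2 fun h' => h (eq_of_associated (hT.associated_of_dvd hL h')))
  exact ⟨key irreducible_X h1, key irreducible_one_add_X h2⟩

theorem isCoprime_of_irreducible {S T : (ZMod 2)[X]} (hS : Irreducible S) (hT : Irreducible T)
    (h : S ≠ T) : IsCoprime S T :=
  hS.coprime_iff_not_dvd.2 fun h' => h (eq_of_associated (hS.associated_of_dvd hT h'))

theorem exists_eq_pow_mul {A T : (ZMod 2)[X]} (hA : A ≠ 0) (hT : Irreducible T) :
    ∃ n B, A = T ^ n * B ∧ ¬ T ∣ B ∧ (T ∣ A → 0 < n) := by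
  obtain ⟨n, B, hB, h⟩ := WfDvdMonoid.max_power_factor hA hT
  refine ⟨n, B, h, hB, fun hd => Nat.pos_of_ne_zero ?_⟩
  rintro rfl
  rw [pow_zero, one_mul] at h
  exact hB (h ▸ hd)

theorem one_add_dvd_of_isBUP {A T : (ZMod 2)[X]} (hA : IsBUP A) (hT : Irreducible T)
    (hd : T ∣ A) : 1 + T ∣ A := by
  obtain ⟨n, B, h, hB, hn⟩ := exists_eq_pow_mul hA.1 hT
  have hc : IsCoprime (T ^ n) B := (hT.coprime_iff_not_dvd.2 hB).pow_left
  have h1 := sigmaBU_mul hc (h ▸ hA.1)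
  rw [← h, hA.2, sigmaBU_prime_pow hT (hn hd)] at h1
  obtain ⟨w, u, α, v, β, hS, hf⟩ := exists_shape (hn hd)
  have hw : w ≠ 0 := by
    rcases hS.cases with ⟨y, h0, hy, -, h, -⟩ | ⟨n, y, h0, hy, -, h, -⟩ <;> omega
  have h2 := hf T (one_add_irreducible_ne_zero hT)
  unfold buSum at h2
  rw [h1, h2]
  exact (((dvd_pow_self _ hw).mul_right _).mul_right _).mul_right _

theorem X_dvd_and_one_add_X_dvd {A T : (ZMod 2)[X]} (hA : IsBUP A) (hT : Irreducible T)
    (hd : T ∣ A) : X ∣ A ∧ 1 + X ∣ A := by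
  have e11 : 1 + (1 + X) = (X : (ZMod 2)[X]) := by rw [← add_assoc, add_self', zero_add]
  have h := one_add_dvd_of_isBUP hA hT hd
  by_cases h1 : T = X
  · subst h1; exact ⟨hd, h⟩
  by_cases h2 : T = 1 + X
  · subst h2; exact ⟨e11 ▸ h, hd⟩
  have ho := odd_of_irreducible hT h1 h2
  exact ⟨(X_dvd_one_add ho.not_X_dvd).trans h, (one_add_X_dvd_one_add ho.not_one_add_X_dvd).trans h⟩

theorem exists_eq_of_dvd {P Q D : (ZMod 2)[X]} (hP : Irreducible P) (hQ : Irreducible Q)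
    {a b h k : ℕ} (hD : D ∣ X ^ a * (1 + X) ^ b * (P ^ h * Q ^ k)) :
    ∃ i j p q, D = X ^ i * (1 + X) ^ j * (P ^ p * Q ^ q) := by
  obtain ⟨A, B, hA, hB, rfl⟩ := exists_dvd_and_dvd_of_dvd_mul hD
  obtain ⟨i, j, rfl⟩ := dvd_pow_mul_pow irreducible_X irreducible_one_add_X hA
  obtain ⟨p, q, rfl⟩ := dvd_pow_mul_pow hP hQ hB
  exact ⟨i, j, p, q, rfl⟩

theorem exists_oddPair {P Q : (ZMod 2)[X]} (hP : Irreducible P) (hQ : Irreducible Q) (hne : P ≠ Q)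
    (oP : Odd' P) (oQ : Odd' Q) (hle : P.natDegree ≤ Q.natDegree) {a b h k : ℕ}
    (dP : 1 + P ∣ X ^ a * (1 + X) ^ b * (P ^ h * Q ^ k))
    (dQ : 1 + Q ∣ X ^ a * (1 + X) ^ b * (P ^ h * Q ^ k)) :
    ∃ i j i' j' l, OddPair P Q i j i' j' l := by
  have hPpos := hP.natDegree_pos
  have hQpos := hQ.natDegree_pos
  have key : ∀ {T : (ZMod 2)[X]} {i j p q : ℕ}, Irreducible T → Odd' T →
      1 + T = X ^ i * (1 + X) ^ j * (P ^ p * Q ^ q) → 0 < i ∧ 0 < j ∧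
        T.natDegree = i + j + (p * P.natDegree + q * Q.natDegree) := by
    intro T i j p q hT oT h
    have oPQ := (oP.pow p).mul (oQ.pow q)
    refine ⟨Nat.pos_of_ne_zero ?_, Nat.pos_of_ne_zero ?_, ?_⟩
    · rintro rfl
      have h1 := X_dvd_one_add oT.not_X_dvd
      rw [h, pow_zero, one_mul] at h1
      exact irreducible_X.not_isUnit
        ((isCoprime_X_one_add_X.symm.pow_left.mul_left oPQ.1).isUnit_of_dvd' h1 dvd_rfl)
    · rintro rfl
      have h1 := one_add_X_dvd_one_add oT.not_one_add_X_dvd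
      rw [h, pow_zero, mul_one] at h1
      exact irreducible_one_add_X.not_isUnit
        ((isCoprime_X_one_add_X.pow_left.mul_left oPQ.2).isUnit_of_dvd' h1 dvd_rfl)
    · rw [← natDegree_one_add hT.natDegree_pos, h, natDegree_mul, natDegree_X_pow_mul,
        natDegree_mul (pow_ne_zero _ hP.ne_zero) (pow_ne_zero _ hQ.ne_zero), natDegree_pow,
        natDegree_pow]
      · exact mul_ne_zero (pow_ne_zero _ X_ne_zero) (pow_ne_zero _ one_add_X_ne_zero)
      · exact mul_ne_zero (pow_ne_zero _ hP.ne_zero) (pow_ne_zero _ hQ.ne_zero)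
  obtain ⟨i, j, p, q, e1⟩ := exists_eq_of_dvd hP hQ dP
  obtain ⟨i', j', l, q', e2⟩ := exists_eq_of_dvd hP hQ dQ
  obtain ⟨hi, hj, h1⟩ := key hP oP e1
  obtain ⟨hi', hj', h2⟩ := key hQ oQ e2
  have hp0 : p = 0 := by
    by_contra h0
    have := Nat.le_mul_of_pos_left P.natDegree (Nat.pos_of_ne_zero h0)
    omega
  have hq0 : q = 0 := by
    by_contra h0
    have := Nat.le_mul_of_pos_left Q.natDegree (Nat.pos_of_ne_zero h0)
    omega
  have hq0' : q' = 0 := by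
    by_contra h0
    have := Nat.le_mul_of_pos_left Q.natDegree (Nat.pos_of_ne_zero h0)
    omega
  subst hp0 hq0 hq0'
  exact ⟨i, j, i', j', l, hP, hQ, hne, oP, oQ, by simpa using e1, by simpa using e2, hle, hi, hj,
    hi', hj'⟩

theorem eq_pow_mul_of_omega {A P Q : (ZMod 2)[X]} (hA : A ≠ 0) (hP : Irreducible P)
    (hQ : Irreducible Q) (hPA : P ∣ A) (hQA : Q ∣ A) (hX : X ∣ A) (hX1 : 1 + X ∣ A) (hne : P ≠ Q)
    (oP : Odd' P) (oQ : Odd' Q)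
    (hall : ∀ T, Irreducible T → T ∣ A → T = X ∨ T = 1 + X ∨ T = P ∨ T = Q) :
    ∃ a b h k, 0 < a ∧ 0 < b ∧ 0 < h ∧ 0 < k ∧ A = X ^ a * (1 + X) ^ b * (P ^ h * Q ^ k) := by
  obtain ⟨a, B1, e1, n1, p1⟩ := exists_eq_pow_mul hA irreducible_X
  have z1 : B1 ≠ 0 := by rintro rfl; simp at n1
  obtain ⟨b, B2, e2, n2, p2⟩ := exists_eq_pow_mul z1 irreducible_one_add_X
  have z2 : B2 ≠ 0 := by rintro rfl; simp at n2
  obtain ⟨h, B3, e3, n3, p3⟩ := exists_eq_pow_mul z2 hP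
  have z3 : B3 ≠ 0 := by rintro rfl; simp at n3
  obtain ⟨k, B4, e4, n4, p4⟩ := exists_eq_pow_mul z3 hQ
  have z4 : B4 ≠ 0 := by rintro rfl; simp at n4
  have d1 : 1 + X ∣ B1 := (isCoprime_X_one_add_X.symm.pow_right).dvd_of_dvd_mul_left (e1 ▸ hX1)
  have d2 : P ∣ B2 := oP.2.pow_right.dvd_of_dvd_mul_left
    (e2 ▸ oP.1.pow_right.dvd_of_dvd_mul_left (e1 ▸ hPA))
  have d3 : Q ∣ B3 := (isCoprime_of_irreducible hQ hP hne.symm).pow_right.dvd_of_dvd_mul_left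
    (e3 ▸ oQ.2.pow_right.dvd_of_dvd_mul_left
      (e2 ▸ oQ.1.pow_right.dvd_of_dvd_mul_left (e1 ▸ hQA)))
  have hB : B4 = 1 := by
    by_contra hB
    obtain ⟨T, hT, hd⟩ := WfDvdMonoid.exists_irreducible_factor
      (fun hu => hB (eq_one_of_isUnit hu)) z4
    have t3 : T ∣ B3 := e4 ▸ hd.mul_left _
    have t2 : T ∣ B2 := e3 ▸ t3.mul_left _
    have t1 : T ∣ B1 := e2 ▸ t2.mul_left _
    have t0 : T ∣ A := e1 ▸ t1.mul_left _
    rcases hall T hT t0 with rfl | rfl | rfl | rfl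
    · exact n1 t1
    · exact n2 t2
    · exact n3 t3
    · exact n4 hd
  exact ⟨a, b, h, k, p1 hX, p2 d1, p3 d2, p4 d3, by rw [e1, e2, e3, e4, hB]; ring⟩

theorem sigmaBU_eq {P Q : (ZMod 2)[X]} (hP : Irreducible P)
    (hQ : Irreducible Q) (hne : P ≠ Q) (oP : Odd' P) (oQ : Odd' Q) {a b h k : ℕ} (ha : 0 < a)
    (hb : 0 < b) (hh : 0 < h) (hk : 0 < k) :
    sigmaBU (X ^ a * (1 + X) ^ b * (P ^ h * Q ^ k)) =
      buSum a X * buSum b (1 + X) * buSum h P * buSum k Q := by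
  have z1 : (X ^ a * (1 + X) ^ b : (ZMod 2)[X]) ≠ 0 :=
    mul_ne_zero (pow_ne_zero _ X_ne_zero) (pow_ne_zero _ one_add_X_ne_zero)
  have z2 : P ^ h * Q ^ k ≠ 0 := mul_ne_zero (pow_ne_zero _ hP.ne_zero) (pow_ne_zero _ hQ.ne_zero)
  have o := (oP.pow h).mul (oQ.pow k)
  rw [sigmaBU_mul (o.1.symm.pow_left.mul_left o.2.symm.pow_left) (mul_ne_zero z1 z2),
    sigmaBU_mul isCoprime_X_one_add_X.pow z1,
    sigmaBU_mul (isCoprime_of_irreducible hP hQ hne).pow z2,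
    sigmaBU_prime_pow irreducible_X ha, sigmaBU_prime_pow irreducible_one_add_X hb,
    sigmaBU_prime_pow hP hh, sigmaBU_prime_pow hQ hk]
  unfold buSum
  ring

theorem exists_solution {A : (ZMod 2)[X]} (hA : IsBUP A) (h4 : omega A = 4) :
    ∃ P Q i j i' j' l a b h k, OddPair P Q i j i' j' l ∧ Solution a b h k i j i' j' l ∧
      A = X ^ a * (1 + X) ^ b * (P ^ h * Q ^ k) := by
  unfold omega at h4
  set Z : Set (ZMod 2)[X] := {T | Irreducible T ∧ T ∣ A} with hZ
  have hfin : Z.Finite := Set.finite_of_ncard_ne_zero (by omega)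
  obtain ⟨T, hT, hTA⟩ : Z.Nonempty := Set.nonempty_of_ncard_ne_zero (by omega)
  obtain ⟨hX, hX1⟩ := X_dvd_and_one_add_X_dvd hA hT hTA
  have hneX : (X : (ZMod 2)[X]) ≠ 1 + X := by
    intro h
    have := congrArg (coeff · 0) h
    simp at this
  have hsub : ({X, 1 + X} : Set (ZMod 2)[X]) ⊆ Z := by
    rintro S (rfl | rfl)
    · exact ⟨irreducible_X, hX⟩
    · exact ⟨irreducible_one_add_X, hX1⟩
  have h2 : (Z \ {X, 1 + X}).ncard = 2 := by
    rw [Set.ncard_sdiff hsub, h4, Set.ncard_pair hneX]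
  obtain ⟨P, Q, hne, hPQ⟩ := Set.ncard_eq_two.1 h2
  wlog hle : P.natDegree ≤ Q.natDegree generalizing P Q
  · exact this Q P hne.symm (by rw [hPQ, Set.pair_comm]) (by omega)
  have hmem : ∀ {S}, S ∈ ({P, Q} : Set (ZMod 2)[X]) → Irreducible S ∧ S ∣ A ∧ Odd' S := by
    intro S hS
    rw [← hPQ] at hS
    obtain ⟨⟨h1, h2⟩, h3⟩ := hS
    simp only [Set.mem_insert_iff, Set.mem_singleton_iff, not_or] at h3
    exact ⟨h1, h2, odd_of_irreducible h1 h3.1 h3.2⟩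
  obtain ⟨hP, hPA, oP⟩ := hmem (S := P) (by simp)
  obtain ⟨hQ, hQA, oQ⟩ := hmem (S := Q) (by simp)
  have hall : ∀ T, Irreducible T → T ∣ A → T = X ∨ T = 1 + X ∨ T = P ∨ T = Q := by
    intro T hT hd
    by_cases h : T ∈ ({X, 1 + X} : Set (ZMod 2)[X])
    · rcases h with h | h
      · exact Or.inl h
      · exact Or.inr (Or.inl h)
    · have : T ∈ Z \ {X, 1 + X} := ⟨⟨hT, hd⟩, h⟩
      rw [hPQ] at this
      exact Or.inr (Or.inr this)
  obtain ⟨a, b, h, k, ha, hb, hh, hk, hAe⟩ :=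
    eq_pow_mul_of_omega hA.1 hP hQ hPA hQA hX hX1 hne oP oQ hall
  obtain ⟨i, j, i', j', l, H⟩ := exists_oddPair hP hQ hne oP oQ hle
    (hAe ▸ one_add_dvd_of_isBUP hA hP hPA) (hAe ▸ one_add_dvd_of_isBUP hA hQ hQA)
  refine ⟨P, Q, i, j, i', j', l, a, b, h, k, H, H.solution ha hb hh hk ?_, hAe⟩
  rw [← sigmaBU_eq hP hQ hne oP oQ ha hb hh hk, ← hAe, hA.2]

/-! ### Identification with the listed polynomials -/

theorem bar_eq {P Q : (ZMod 2)[X]} (a b h k : ℕ) :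
    bar (X ^ a * (1 + X) ^ b * (P ^ h * Q ^ k)) =
      X ^ b * (1 + X) ^ a * (bar P ^ h * bar Q ^ k) := by
  have e : (1 + X : (ZMod 2)[X]).comp (X + 1) = X := by rw [add_comm X 1, one_add_X_comp]
  unfold bar
  rw [mul_comp, mul_comp, mul_comp, pow_comp, pow_comp, pow_comp, pow_comp, X_comp, e]
  ring

theorem one_add_X_mul_one_add_X : 1 + X ^ 1 * (1 + X) ^ 1 = M1 := by unfold M1; ring

theorem one_add_X_mul_one_add_X_sq : 1 + X ^ 1 * (1 + X) ^ 2 = M2 := by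
  unfold M2
  linear_combination X ^ 2 * two_eq_zero'

theorem one_add_X_sq_mul_one_add_X : 1 + X ^ 2 * (1 + X) ^ 1 = M3 := by unfold M3; ring

theorem one_add_X_mul_one_add_X_cube : 1 + X ^ 1 * (1 + X) ^ 3 = M4 := by
  unfold M4
  linear_combination (X ^ 2 + X ^ 3) * two_eq_zero'

theorem one_add_X_cube_mul_one_add_X : 1 + X ^ 3 * (1 + X) ^ 1 = M5 := by unfold M5; ring

theorem one_add_X_mul_one_add_X_mul_M1 : 1 + X ^ 1 * (1 + X) ^ 1 * M1 ^ 1 = S1 := by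
  unfold M1 S1
  linear_combination (X ^ 2 + X ^ 3) * two_eq_zero'

theorem bar_one_add (i j : ℕ) (T : (ZMod 2)[X]) :
    bar (1 + X ^ i * (1 + X) ^ j * T) = 1 + X ^ j * (1 + X) ^ i * bar T := by
  have e : (1 + X : (ZMod 2)[X]).comp (X + 1) = X := by rw [add_comm X 1, one_add_X_comp]
  unfold bar
  rw [add_comp, one_comp, mul_comp, mul_comp, pow_comp, pow_comp, X_comp, e]
  ring

theorem bar_one_add' (i j : ℕ) :
    bar (1 + X ^ i * (1 + X) ^ j) = 1 + X ^ j * (1 + X) ^ i := by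
  have := bar_one_add i j 1
  simpa [bar] using this

theorem bar_M1 : bar M1 = M1 := by rw [← one_add_X_mul_one_add_X, bar_one_add']

theorem bar_M2 : bar M2 = M3 := by
  rw [← one_add_X_mul_one_add_X_sq, bar_one_add', one_add_X_sq_mul_one_add_X]

theorem bar_M3 : bar M3 = M2 := by
  rw [← one_add_X_sq_mul_one_add_X, bar_one_add', one_add_X_mul_one_add_X_sq]

theorem bar_M4 : bar M4 = M5 := by
  rw [← one_add_X_mul_one_add_X_cube, bar_one_add', one_add_X_cube_mul_one_add_X]

theorem bar_M5 : bar M5 = M4 := by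
  rw [← one_add_X_cube_mul_one_add_X, bar_one_add', one_add_X_mul_one_add_X_cube]

theorem bar_S1 : bar S1 = S1 := by
  rw [← one_add_X_mul_one_add_X_mul_M1, bar_one_add, pow_one M1, bar_M1]

/-- The set of the eight polynomials of the theorem. -/
def IsListed (A : (ZMod 2)[X]) : Prop :=
  A = C8 ∨ A = C9 ∨ A = C10 ∨ A = C11 ∨ A = C12 ∨ A = C13 ∨ A = D1 ∨ A = D2

theorem isListed_of_solution {P Q : (ZMod 2)[X]} {i j i' j' l a b h k : ℕ}
    (H : OddPair P Q i j i' j' l) (hS : Solution a b h k i j i' j' l) :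
    IsListed (X ^ a * (1 + X) ^ b * (P ^ h * Q ^ k)) ∨
      IsListed (bar (X ^ a * (1 + X) ^ b * (P ^ h * Q ^ k))) := by
  have eP := eq_add_one_of_one_add_eq H.eqP
  have eQ := eq_add_one_of_one_add_eq H.eqQ
  rw [bar_eq]
  have hX : (1 + X : (ZMod 2)[X]) = X + 1 := add_comm _ _
  rcases hS with ⟨rfl, rfl, rfl, rfl, rfl, h⟩ | ⟨rfl, rfl, rfl, rfl, rfl, h⟩ |
    ⟨rfl, rfl, rfl, rfl, rfl, rfl, rfl, rfl, rfl⟩ | ⟨rfl, rfl, rfl, rfl, rfl, rfl, rfl, rfl, rfl⟩ |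
    ⟨⟨rfl, rfl, rfl, rfl, rfl⟩ | ⟨rfl, rfl, rfl, rfl, rfl⟩, rfl, rfl, h⟩ |
    ⟨rfl, rfl, rfl, rfl, rfl, h⟩
  · rw [pow_zero, mul_one, one_add_X_cube_mul_one_add_X] at eQ
    rw [one_add_X_mul_one_add_X_cube] at eP
    subst eP eQ
    rw [bar_M4, bar_M5, hX]
    unfold IsListed C8 C9 C12
    rcases h with ⟨rfl, rfl, rfl, rfl⟩ | ⟨rfl, rfl, rfl, rfl⟩ | ⟨rfl, rfl, rfl, rfl⟩ |
      ⟨rfl, rfl, rfl, rfl⟩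
    · left; left; ring
    · left; right; left; ring
    · right; right; left; ring
    · left; right; right; right; right; left; ring
  · rw [pow_zero, mul_one, one_add_X_mul_one_add_X_cube] at eQ
    rw [one_add_X_cube_mul_one_add_X] at eP
    subst eP eQ
    rw [bar_M4, bar_M5, hX]
    unfold IsListed C8 C9 C12
    rcases h with ⟨rfl, rfl, rfl, rfl⟩ | ⟨rfl, rfl, rfl, rfl⟩ | ⟨rfl, rfl, rfl, rfl⟩ |
      ⟨rfl, rfl, rfl, rfl⟩
    · left; left; ring
    · left; right; left; ring
    · right; right; left; ring
    · left; right; right; right; right; left; ring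
  · rw [pow_zero, mul_one, one_add_X_cube_mul_one_add_X] at eQ
    rw [one_add_X_mul_one_add_X] at eP
    subst eP eQ
    unfold IsListed C10
    left; right; right; left
    ring
  · rw [pow_zero, mul_one, one_add_X_mul_one_add_X_cube] at eQ
    rw [one_add_X_mul_one_add_X] at eP
    subst eP eQ
    rw [bar_M1, bar_M4]
    unfold IsListed C10
    right; right; right; left
    ring
  · rw [pow_zero, mul_one, one_add_X_sq_mul_one_add_X] at eQ
    rw [one_add_X_mul_one_add_X_sq] at eP
    subst eP eQ
    rw [bar_M2, bar_M3, hX]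
    unfold IsListed C11 C13
    rcases h with ⟨rfl, rfl⟩ | ⟨rfl, rfl⟩ | ⟨rfl, rfl⟩
    · left; right; right; right; left; ring
    · right; right; right; right; left; ring
    · left; right; right; right; right; right; left; ring
  · rw [pow_zero, mul_one, one_add_X_mul_one_add_X_sq] at eQ
    rw [one_add_X_sq_mul_one_add_X] at eP
    subst eP eQ
    rw [bar_M2, bar_M3, hX]
    unfold IsListed C11 C13
    rcases h with ⟨rfl, rfl⟩ | ⟨rfl, rfl⟩ | ⟨rfl, rfl⟩
    · left; right; right; right; left; ring
    · right; right; right; right; left; ring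
    · left; right; right; right; right; right; left; ring
  · rw [one_add_X_mul_one_add_X] at eP
    subst eP
    rw [one_add_X_mul_one_add_X_mul_M1] at eQ
    subst eQ
    rw [bar_M1, bar_S1, hX]
    unfold IsListed D1 D2
    rcases h with ⟨rfl, rfl, rfl, rfl⟩ | ⟨rfl, rfl, rfl, rfl⟩ | ⟨rfl, rfl, rfl, rfl⟩ |
      ⟨rfl, rfl, rfl, rfl⟩
    · left; right; right; right; right; right; right; left; ring
    · right; right; right; right; right; right; right; left; ring
    · left; right; right; right; right; right; right; right; ring
    · right; right; right; right; right; right; right; right; ring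

/-! ### Odd prime divisors are Mersenne primes -/

theorem natDegree_one_add_X_pow_mul {i : ℕ} (j : ℕ) (hi : 0 < i) :
    (1 + X ^ i * (1 + X) ^ j : (ZMod 2)[X]).natDegree = i + j := by
  rw [natDegree_one_add (by rw [natDegree_X_pow_mul]; omega), natDegree_X_pow_mul]

/-- When the order of 2 modulo u is at least deg M, every prime factor of M already has full degree.
-/
theorem eq_of_irreducible_dvd {T M : (ZMod 2)[X]} {u : ℕ} (hT : Irreducible T) (hu : u.Prime)
    (hodd : Odd u) (hM : M ∣ geo u X) (hTM : T ∣ M)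
    (hd : ∀ d, d < M.natDegree → d ≠ 0 → ¬ u ∣ 2 ^ d - 1) : T = M := by
  have hM0 : M ≠ 0 := by
    rintro rfl
    exact geo_ne_zero hu.pos X (by simp) (zero_dvd_iff.1 hM)
  have h1 := dvd_two_pow_natDegree_sub_one hT hu hodd (hTM.trans hM)
  have h2 : M.natDegree ≤ T.natDegree := by
    by_contra h
    exact hd _ (not_le.1 h) hT.natDegree_pos.ne' h1
  exact eq_of_associated (associated_of_dvd_of_natDegree_le hTM hM0 h2)

theorem geo_three_X : geo 3 X = M1 := by
  simp [geo, Finset.sum_range_succ, M1]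

theorem geo_five_X : geo 5 X = M4 := by
  simp [geo, Finset.sum_range_succ, M4]

theorem geo_seven_X : geo 7 X = M2 * M3 := by
  simp only [geo, Finset.sum_range_succ, Finset.sum_range_zero, M2, M3]
  linear_combination (- X ^ 3 : (ZMod 2)[X]) * two_eq_zero'

theorem eq_M1 {T : (ZMod 2)[X]} (hT : Irreducible T) (h : T ∣ M1) : T = M1 := by
  refine eq_of_irreducible_dvd hT Nat.prime_three (by decide) geo_three_X.symm.dvd h ?_
  rw [← one_add_X_mul_one_add_X, natDegree_one_add_X_pow_mul _ one_pos]
  decide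

theorem eq_M2 {T : (ZMod 2)[X]} (hT : Irreducible T) (h : T ∣ M2) : T = M2 := by
  refine eq_of_irreducible_dvd hT (u := 7) (by norm_num) (by decide)
    (geo_seven_X ▸ Dvd.intro _ rfl) h ?_
  rw [← one_add_X_mul_one_add_X_sq, natDegree_one_add_X_pow_mul _ one_pos]
  decide

theorem eq_M3 {T : (ZMod 2)[X]} (hT : Irreducible T) (h : T ∣ M3) : T = M3 := by
  refine eq_of_irreducible_dvd hT (u := 7) (by norm_num) (by decide)
    (geo_seven_X ▸ Dvd.intro_left _ rfl) h ?_
  rw [← one_add_X_sq_mul_one_add_X, natDegree_one_add_X_pow_mul _ two_pos]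
  decide

theorem eq_M4 {T : (ZMod 2)[X]} (hT : Irreducible T) (h : T ∣ M4) : T = M4 := by
  refine eq_of_irreducible_dvd hT Nat.prime_five (by decide) geo_five_X.symm.dvd h ?_
  rw [← one_add_X_mul_one_add_X_cube, natDegree_one_add_X_pow_mul _ one_pos]
  decide

/-- The roots of `M5` have order 15, which is not prime, so the order criterion is transported from
`M4` by x ↦ x+1. -/
theorem eq_M5 {T : (ZMod 2)[X]} (hT : Irreducible T) (h : T ∣ M5) : T = M5 := by
  have hb : ∀ S : (ZMod 2)[X], bar S = S.comp (1 + X) := fun S => by rw [bar, add_comm]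
  have h1 := map_dvd (compRingHom (1 + X)) h
  rw [coe_compRingHom_apply, coe_compRingHom_apply, ← hb M5, bar_M5] at h1
  have h2 := eq_M4 (irreducible_comp hT) h1
  rw [← comp_comp_one_add_X T, h2, ← hb, bar_M4]

theorem isMersennePrime_of_eq {T : (ZMod 2)[X]} (hT : Irreducible T) {a b : ℕ} (ha : 0 < a)
    (hb : 0 < b) (hab : Nat.Coprime a b) (h : T = 1 + X ^ a * (1 + X) ^ b) : IsMersennePrime T :=
  ⟨hT, a, b, ha, hb, hab, by rw [h, add_comm X 1]⟩

theorem isMersennePrime_of_dvd {T : (ZMod 2)[X]} (hT : Irreducible T)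
    (h : T ∣ M1 ∨ T ∣ M2 ∨ T ∣ M3 ∨ T ∣ M4 ∨ T ∣ M5) : IsMersennePrime T := by
  rcases h with h | h | h | h | h
  · exact isMersennePrime_of_eq hT one_pos one_pos (by decide)
      ((eq_M1 hT h).trans one_add_X_mul_one_add_X.symm)
  · exact isMersennePrime_of_eq hT one_pos two_pos (by decide)
      ((eq_M2 hT h).trans one_add_X_mul_one_add_X_sq.symm)
  · exact isMersennePrime_of_eq hT two_pos one_pos (by decide)
      ((eq_M3 hT h).trans one_add_X_sq_mul_one_add_X.symm)
  · exact isMersennePrime_of_eq hT one_pos three_pos (by decide)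
      ((eq_M4 hT h).trans one_add_X_mul_one_add_X_cube.symm)
  · exact isMersennePrime_of_eq hT three_pos one_pos (by decide)
      ((eq_M5 hT h).trans one_add_X_cube_mul_one_add_X.symm)

theorem dvd_or_dvd_of_isOdd {T R S : (ZMod 2)[X]} (hT : Irreducible T) (ho : IsOdd T)
    {a b h k : ℕ} (hd : T ∣ X ^ a * (X + 1) ^ b * R ^ h * S ^ k) : T ∣ R ∨ T ∣ S := by
  have h1 : IsCoprime T (X ^ a * (X + 1) ^ b) :=
    ho.of_mul_right_left.pow_right.mul_right ho.of_mul_right_right.pow_right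
  rw [mul_assoc] at hd
  rcases hT.prime.dvd_or_dvd (h1.dvd_of_dvd_mul_left hd) with h | h
  · exact Or.inl (hT.prime.dvd_of_dvd_pow h)
  · exact Or.inr (hT.prime.dvd_of_dvd_pow h)

end BiunitaryPerfect

theorem theorem2 :
    (∀ A : (ZMod 2)[X], BiunitaryPerfect.IsBUP A → BiunitaryPerfect.omega A = 4 →
      A ∈ ({BiunitaryPerfect.C8, BiunitaryPerfect.C9, BiunitaryPerfect.C10, BiunitaryPerfect.C11,
          BiunitaryPerfect.C12, BiunitaryPerfect.C13} ∪
          {BiunitaryPerfect.D1, BiunitaryPerfect.D2} : Set (ZMod 2)[X]) ∨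
      BiunitaryPerfect.bar A ∈ ({BiunitaryPerfect.C8, BiunitaryPerfect.C9, BiunitaryPerfect.C10,
          BiunitaryPerfect.C11, BiunitaryPerfect.C12, BiunitaryPerfect.C13} ∪
          {BiunitaryPerfect.D1, BiunitaryPerfect.D2} : Set (ZMod 2)[X])) ∧
    (∀ C ∈ ({BiunitaryPerfect.C8, BiunitaryPerfect.C9, BiunitaryPerfect.C10, BiunitaryPerfect.C11,
          BiunitaryPerfect.C12, BiunitaryPerfect.C13} : Set (ZMod 2)[X]),
      ∀ T : (ZMod 2)[X], Irreducible T → BiunitaryPerfect.IsOdd T → T ∣ C →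
        BiunitaryPerfect.IsMersennePrime T) := by 
  open BiunitaryPerfect in
  constructor
  · intro A hA h4
    obtain ⟨P, Q, i, j, i', j', l, a, b, h, k, H, hS, rfl⟩ := exists_solution hA h4
    have key : ∀ {B : (ZMod 2)[X]}, IsListed B →
        B ∈ ({C8, C9, C10, C11, C12, C13} ∪ {D1, D2} : Set (ZMod 2)[X]) := by
      intro B hB
      unfold IsListed at hB
      simpa only [Set.mem_union, Set.mem_insert_iff, Set.mem_singleton_iff, or_assoc] using hB
    exact (isListed_of_solution H hS).imp key key
  · intro C hC T hT ho hd
    apply isMersennePrime_of_dvd hT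
    rcases hC with rfl | rfl | rfl | rfl | rfl | rfl
    · unfold C8 at hd
      rcases dvd_or_dvd_of_isOdd hT ho (a := 8) (b := 8) (R := M4) (h := 1) (S := M5) (k := 1)
        (by simpa only [pow_one] using hd) with h | h <;> simp only [h, true_or, or_true]
    · unfold C9 at hd
      rcases dvd_or_dvd_of_isOdd hT ho (a := 8) (b := 9) (R := M4) (h := 1) (S := M5) (k := 2)
        (by simpa only [pow_one] using hd) with h | h <;> simp only [h, true_or, or_true]
    · unfold C10 at hd
      rcases dvd_or_dvd_of_isOdd hT ho (a := 7) (b := 10) (R := M1) (h := 2) (S := M5) (k := 1)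
        (by simpa only [pow_one] using hd) with h | h <;> simp only [h, true_or, or_true]
    · unfold C11 at hd
      rcases dvd_or_dvd_of_isOdd hT ho (a := 7) (b := 13) (R := M2) (h := 2) (S := M3) (k := 2)
        hd with h | h <;> simp only [h, true_or, or_true]
    · unfold C12 at hd
      rcases dvd_or_dvd_of_isOdd hT ho (a := 9) (b := 9) (R := M4) (h := 2) (S := M5) (k := 2)
        hd with h | h <;> simp only [h, true_or, or_true]
    · unfold C13 at hd
      rcases dvd_or_dvd_of_isOdd hT ho (a := 14) (b := 14) (R := M2) (h := 2) (S := M3) (k := 2)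
        hd with h | h <;> simp only [h, true_or, or_true]
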